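/- **Setting.** Let $\mathcal{S}$ be a signature, i.e. a set with an arity map $\mathrm{ar} : \mathcal{S} \to \mathbb{N}$, and let $\mathbb{K}$ be a field. An *$\mathcal{S}$-term* is either the leaf $|$ or $s\,t_1 \cdots t_{\mathrm{ar}(s)}$ with $s \in \mathcal{S}$ and $t_1, \dots, t_{\mathrm{ar}(s)}$ $\mathcal{S}$-terms; it is a decorated ordered rooted tree. The internal nodes of a term $t$ are numbered $1, 2, \dots, \deg t$ in preorder, and $\mathrm{dc}(t)$ is the word of their decorations. For an internal node $i$, let $\mathrm{pa}(i)$ be its parent and $\mathrm{lp}(i)$ its position (from $1$, left to right) among the children of its parent; by convention $\mathrm{pa}(1) = 1$ and $\mathrm{lp}(1) = 0$. The *connection word* of $t$ has letters $\mathrm{cnc}_t(i) = \mathrm{pa}(i) + 1 - 2^{\mathrm{lp}(i) - a}$, where $a$ is the arity of the decoration of $\mathrm{pa}(i)$. The *easterly wind order* is defined by $t \preccurlyeq t'$ iff $\mathrm{dc}(t) = \mathrm{dc}(t')$ and $\mathrm{cnc}_t(i) \le \mathrm{cnc}_{t'}(i)$ for all $i$. A leaf of $t$ is *extreme* if it is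 visited after all the internal nodes in the preorder traversal. An *$\mathcal{S}$-forest* $f = n\,t_1 \cdots t_n$ is a term on the signature $\mathcal{S} \sqcup \mathbb{N}$ (where $n \in \mathbb{N}$ has arity $n$) with root decorated by $n \in \mathbb{N}$, where $t_1, \dots, t_n$ are $\mathcal{S}$-terms. It is *leaning* if $\deg f = n + 1$ (its *size* is then $n$) and if, among $t_1, \dots, t_n$, the terms different from the leaf precede the leaves. Let $\mathfrak{L}(\mathcal{S})$ be the set of leaning $\mathcal{S}$-forests, ordered by $\preccurlyeq$, with Möbius function $\mu$. All the sets $\{f' \in \mathfrak{L}(\mathcal{S}) : f \preccurlyeq f'\}$ and $\{f' \in \mathfrak{L}(\mathcal{S}) : f' \preccurlyeq f\}$ are finite. The natural Hopf algebra of the free operad on $\mathcal{S}$ is, as an algebra, the $\mathbb{K}$-linear span of elements $\mathsf{E}_w$, where $w$ ranges over the words on the set of $\mathcal{S}$-terms different from the leaf, with product $\mathsf{E}_{w} \cdot \mathsf{E}_{w'} = \mathsf{E}_{w w'}$ (concatenation). For $f = n\,t_1 \cdots t_n \in \mathfrak{L}(\mathcal{S})$, let $\mathsf{E}_f := \mathsf{E}_{(t_1,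 \dots, t_k)}$, where $t_1, \dots, t_k$ are the terms among $t_1, \dots, t_n$ which are not leaves, and set $$\mathsf{F}_f := \sum_{f' \in \mathfrak{L}(\mathcal{S}),\ f \preccurlyeq f'} \mu(f, f')\, \mathsf{E}_{f'}, \qquad \mathsf{H}_f := \sum_{f' \in \mathfrak{L}(\mathcal{S}),\ f' \preccurlyeq f} \mathsf{F}_{f'}.$$ For leaning forests $f_1, f_2$ of sizes $n_1, n_2$, with $r$ the number of extreme leaves of $f_1$, let $f_1 \mathbin{\mathrm{under}} f_2$ be the leaning forest, of size $n_1 + n_2$, obtained as follows: append $n_2$ leaves at the right of the children of the root of $f_1$ (and decorate the root by $n_1 + n_2$), append $r$ leaves at the right of the list of the children subterms of the root of $f_2$, and graft, for every $j \in \{1, \dots, n_2 + r\}$, the $j$-th subterm of this list onto the $j$-th extreme leaf (from left to right) of the extended $f_1$. **Theorem.** For every signature $\mathcal{S}$ and all leaning $\mathcal{S}$-forests $f_1$ and $f_2$, $$\mathsf{H}_{f_1} \cdot \mathsf{H}_{f_2} = \mathsf{H}_{f_1 \mathbin{\mathrm{under}} f_2}.$$ -/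

import Mathlib

universe u v

namespace EasterlyWind

/-- Terms over the signature `S` with arity map `ar`: ordered rooted trees whose internal nodes are
decorated by symbols `s`, a node decorated by `s` having exactly `ar s` children. -/
inductive Term {S : Type u} (ar : S → ℕ) : Type u
  | leaf : Term ar
  | node (s : S) (children : Fin (ar s) → Term ar) : Term ar

namespace Term

variable {S : Type u} {ar : S → ℕ}

instance decidableEqLeaf : ∀ t : Term ar, Decidable (t = leaf)
  | leaf => isTrue rfl
  | node _ _ => isFalse (fun h => Term.noConfusion rfl (heq_of_eq rfl) (heq_of_eq h))

/-- The preorder traversal: an internal node decorated by `s` is recorded as `some s`, a leaf as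
`none`. -/
def preorder : Term ar → List (Option S)
  | leaf => [none]
  | node s c => some s :: (List.ofFn fun j => (c j).preorder).flatten

/-- The decoration word: the decorations of the internal nodes, in preorder. -/
def dc (t : Term ar) : List S := t.preorder.reduceOption

/-- The degree: the number of internal nodes. -/
def deg (t : Term ar) : ℕ := t.dc.length

/-- The number of leaves. -/
def numLeaves (t : Term ar) : ℕ := t.preorder.countP Option.isNone

/-- The number of extreme leaves, i.e. of leaves visited after all the internal nodes in the
preorder traversal. They are the last `t.numExtreme` leaves of `t`. -/
def numExtreme (t : Term ar) : ℕ := (t.preorder.reverse.takeWhile Option.isNone).length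

/-- Internal nodes are numbered `1, 2, …` in preorder. `t.edgesFrom k e` lists, for the internal
nodes of a subterm `t` in preorder, the pairs (parent, local position), where `k` is the number of
the root of the subterm `t` and `e` is the pair attached to this root. Local positions start
at `1`. -/
def edgesFrom : Term ar → ℕ → ℕ × ℕ → List (ℕ × ℕ)
  | leaf, _, _ => []
  | node _ c, k, e => e :: (List.ofFn fun j =>
      (c j).edgesFrom (k + 1 + ∑ i ∈ Finset.Iio j, (c i).deg) (k, (j : ℕ) + 1)).flatten

/-- The list of the pairs (parent, local position) of the internal nodes `1, 2, …` of `t`. By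
convention the root `1` is its own parent, with local position `0`. -/
def parentEdges (t : Term ar) : List (ℕ × ℕ) := t.edgesFrom 1 (1, 0)

/-- The arity of the decoration of the internal node number `i ≥ 1`. -/
def arityAt (t : Term ar) (i : ℕ) : ℕ := (t.dc.map ar).getD (i - 1) 0

/-- The connection word: the letter of a node with parent `p` and local position `l` is
`p + 1 - 2 ^ (l - arity of p)`. -/
def cnc (t : Term ar) : List ℚ :=
  t.parentEdges.map fun e => (e.1 : ℚ) + 1 - (2 : ℚ) ^ ((e.2 : ℤ) - (t.arityAt e.1 : ℤ))

theorem forall₂_le_trans : ∀ {a b c : List ℚ}, List.Forall₂ (· ≤ ·) a b →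
    List.Forall₂ (· ≤ ·) b c → List.Forall₂ (· ≤ ·) a c
  | _, _, _, .nil, .nil => .nil
  | _, _, _, .cons h₁ t₁, .cons h₂ t₂ => .cons (le_trans h₁ h₂) (forall₂_le_trans t₁ t₂)

/-- The easterly wind order: same decoration word, and letterwise comparison of the connection
words. -/
instance instPreorder : Preorder (Term ar) where
  le t₁ t₂ := t₁.dc = t₂.dc ∧ List.Forall₂ (· ≤ ·) t₁.cnc t₂.cnc
  le_refl t := ⟨rfl, List.forall₂_refl _⟩
  le_trans _ _ _ h₁ h₂ := ⟨h₁.1.trans h₂.1, forall₂_le_trans h₁.2 h₂.2⟩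

/-- Substitution for the leaves of `t`: the `i`-th leaf (`i = 0, 1, …`, in preorder) is replaced by
`σ (k + i)`. -/
def leafSubst (σ : ℕ → Term ar) : Term ar → ℕ → Term ar
  | leaf, k => σ k
  | node s c, k => node s fun j =>
      leafSubst σ (c j) (k + ∑ i ∈ Finset.Iio j, (c i).numLeaves)

end Term

/-- The arity map of the signature `S ⊔ ℕ`, in which the symbol `n : ℕ` has arity `n`. -/
abbrev forestArity {S : Type u} (ar : S → ℕ) : S ⊕ ℕ → ℕ := Sum.elim ar id

/-- A term on the signature `S`, seen as a term on the signature `S ⊔ ℕ`. -/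
def Term.lift {S : Type u} {ar : S → ℕ} : Term ar → Term (forestArity ar)
  | .leaf => .leaf
  | .node s c => .node (Sum.inl s) fun j => (c j).lift

/-- A forest `n t₁ … tₙ`. -/
structure Forest {S : Type u} (ar : S → ℕ) : Type u where
  n : ℕ
  trees : Fin n → Term ar

namespace Forest

variable {S : Type u} {ar : S → ℕ}

/-- The forest `n t₁ … tₙ` as a term on the signature `S ⊔ ℕ` with root decorated by `n`. -/
def toTerm (f : Forest ar) : Term (forestArity ar) :=
  .node (Sum.inr f.n) fun j => (f.trees j).lift

/-- Concatenation of forests. -/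
def concat (f g : Forest ar) : Forest ar := ⟨f.n + g.n, Fin.append f.trees g.trees⟩

/-- The corolla whose root is decorated by `n : ℕ`. -/
def corolla (n : ℕ) : Forest ar := ⟨n, fun _ => .leaf⟩

/-- `n t₁ … tₙ` is balanced if its degree is `n + 1`. -/
def IsBalanced (f : Forest ar) : Prop := f.toTerm.deg = f.n + 1

/-- The forest is tilted at its root (internal node `1`): the children of the root which are not
leaves precede the children of the root which are leaves. -/
def IsRootTilted (f : Forest ar) : Prop :=
  ∀ i j, i < j → f.trees i = .leaf → f.trees j = .leaf

/-- Leaning forests are the balanced forests which are tilted at the root. -/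
def IsLeaning (f : Forest ar) : Prop := f.IsBalanced ∧ f.IsRootTilted

/-- Substitution for the leaves of a forest: the `i`-th leaf (`i = 0, 1, …`, in preorder) is
replaced by `σ i`. -/
def leafSubst (f : Forest ar) (σ : ℕ → Term ar) : Forest ar :=
  ⟨f.n, fun j => (f.trees j).leafSubst σ (∑ i ∈ Finset.Iio j, (f.trees i).numLeaves)⟩

/-- Grafting, for all `j`, the `j`-th child subterm of the root of `h` onto the `j`-th extreme leaf
of `g`. -/
def graftExtreme (g h : Forest ar) : Forest ar :=
  g.leafSubst fun i =>
    if hi : g.toTerm.numLeaves - g.toTerm.numExtreme ≤ i ∧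
        i - (g.toTerm.numLeaves - g.toTerm.numExtreme) < h.n then
      h.trees ⟨i - (g.toTerm.numLeaves - g.toTerm.numExtreme), hi.2⟩
    else .leaf

/-- The under operation: with `n₂` the size of `f₂` and `r` the number of extreme leaves of `f₁`,
graft the child subterms of the root of the concatenation of `f₂` and of the `r`-corolla onto the
extreme leaves of the concatenation of `f₁` and of the `n₂`-corolla. -/
def under (f₁ f₂ : Forest ar) : Forest ar :=
  (f₁.concat (corolla f₂.n)).graftExtreme (f₂.concat (corolla f₁.toTerm.numExtreme))

end Forest

/-! ### The under operation preserves leaning forests -/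

namespace Term

variable {S : Type u} {ar : S → ℕ}

theorem dc_node (s : S) (c : Fin (ar s) → Term ar) :
    (node s c).dc = s :: (List.ofFn fun j => (c j).dc).flatten := by
  simp only [dc, preorder, List.reduceOption_cons_of_some]
  simp only [List.reduceOption, List.filterMap_flatten, List.map_ofFn]
  rfl

theorem deg_node (s : S) (c : Fin (ar s) → Term ar) :
    (node s c).deg = 1 + ∑ j, (c j).deg := by
  rw [deg, dc_node, List.length_cons, List.length_flatten, List.map_ofFn, List.sum_ofFn, add_comm]
  rfl

theorem numLeaves_node (s : S) (c : Fin (ar s) → Term ar) :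
    (node s c).numLeaves = ∑ j, (c j).numLeaves := by
  rw [numLeaves, preorder, List.countP_cons_of_neg (by simp), List.countP_flatten, List.map_ofFn,
    List.sum_ofFn]
  rfl

theorem sum_range_blocks {n : ℕ} (a : Fin n → ℕ) (F : ℕ → ℕ) (k : ℕ) :
    ∑ j, ∑ i ∈ Finset.range (a j), F (k + ∑ l ∈ Finset.Iio j, a l + i)
      = ∑ i ∈ Finset.range (∑ j, a j), F (k + i) := by
  induction n with
  | zero => simp
  | succ n ih =>
    rw [Fin.sum_univ_castSucc, Fin.sum_univ_castSucc, Finset.sum_range_add]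
    have h1 : ∀ j : Fin n, ∑ l ∈ Finset.Iio j.castSucc, a l
        = ∑ l ∈ Finset.Iio j, a l.castSucc := by
      intro j
      rw [Fin.Iio_castSucc, Finset.sum_map]
      rfl
    have h2 : ∑ l ∈ Finset.Iio (Fin.last n), a l = ∑ l : Fin n, a l.castSucc := by
      rw [Fin.Iio_last_eq_map, Finset.sum_map]
      rfl
    simp only [h1, h2]
    rw [ih (fun j => a j.castSucc)]
    simp only [add_assoc]

theorem deg_leafSubst (σ : ℕ → Term ar) (t : Term ar) (k : ℕ) :
    (t.leafSubst σ k).deg = t.deg + ∑ i ∈ Finset.range t.numLeaves, (σ (k + i)).deg := by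
  induction t generalizing k with
  | leaf => simp [leafSubst, numLeaves, preorder, deg, dc]
  | node s c ih =>
    rw [leafSubst, deg_node, deg_node, numLeaves_node]
    simp only [ih, Finset.sum_add_distrib]
    rw [sum_range_blocks (fun j => (c j).numLeaves) (fun i => (σ i).deg), add_assoc]

theorem preorder_lift (t : Term ar) : t.lift.preorder = t.preorder.map (Option.map Sum.inl) := by
  induction t with
  | leaf => rfl
  | node s c ih =>
    simp only [lift, preorder, List.map_cons, Option.map_some, List.map_flatten, List.map_ofFn]
    congr 2
    exact List.ofFn_inj.2 (funext fun j => ih j)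

theorem numLeaves_lift (t : Term ar) : t.lift.numLeaves = t.numLeaves := by
  rw [numLeaves, preorder_lift, List.countP_map]
  congr 1
  funext o
  cases o <;> rfl

theorem deg_lift (t : Term ar) : t.lift.deg = t.deg := by
  induction t with
  | leaf => rfl
  | node s c ih =>
    rw [lift, deg_node, deg_node]
    congr 1
    exact Finset.sum_congr rfl fun j _ => ih j

theorem deg_leaf : (leaf : Term ar).deg = 0 := rfl

theorem lift_injective : Function.Injective (lift : Term ar → Term (forestArity ar)) := by
  intro t
  induction t with
  | leaf => intro t' h; cases t' with
    | leaf => rfl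
    | node s c => simp [lift] at h
  | node s c ih => intro t' h; cases t' with
    | leaf => simp [lift] at h
    | node s' c' =>
      simp only [lift, node.injEq, Sum.inl.injEq] at h
      obtain ⟨rfl, h⟩ := h
      congr 1
      funext j
      exact ih j (congrFun (eq_of_heq h) j)

/-- There are finitely many terms with a given decoration word. -/
theorem finite_setOf_dc_eq (w : List S) : {t : Term ar | t.dc = w}.Finite := by
  have key : ∀ n : ℕ, {t : Term ar | t.deg ≤ n ∧ ∀ s ∈ t.dc, s ∈ w}.Finite := by
    intro n
    induction n with
    | zero =>
      refine (Set.finite_singleton leaf).subset ?_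
      rintro (_ | ⟨s, c⟩) ⟨h, -⟩
      · rfl
      · rw [deg_node] at h; omega
    | succ n ih =>
      have hfin : ({leaf} ∪ ⋃ s ∈ {s | s ∈ w}, (node s) ''
          (Set.pi Set.univ fun _ : Fin (ar s) =>
            {t : Term ar | t.deg ≤ n ∧ ∀ s ∈ t.dc, s ∈ w})).Finite :=
        (Set.finite_singleton _).union
          ((List.finite_toSet w).biUnion fun s _ => (Set.Finite.pi' fun _ => ih).image _ |>.subset
            (Set.image_mono fun x hx i => hx i trivial))
      refine hfin.subset ?_
      rintro (_ | ⟨s, c⟩) ⟨h, hw⟩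
      · exact Or.inl rfl
      · refine Or.inr (Set.mem_biUnion (x := s) (hw s (by simp [dc_node])) ⟨c, ?_, rfl⟩)
        intro j _
        refine ⟨?_, fun s' hs' => hw s' ?_⟩
        · rw [deg_node] at h
          have := Finset.single_le_sum (f := fun j => (c j).deg) (fun _ _ => Nat.zero_le _)
            (Finset.mem_univ j)
          omega
        · rw [dc_node]
          refine List.mem_cons_of_mem _ (List.mem_flatten.2 ⟨_, ?_, hs'⟩)
          exact (List.mem_ofFn' _ _).2 ⟨j, rfl⟩
  refine (key w.length).subset ?_
  rintro t rfl
  exact ⟨le_rfl, fun _ h => h⟩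

end Term

namespace Forest

variable {S : Type u} {ar : S → ℕ}

theorem deg_toTerm (f : Forest ar) : f.toTerm.deg = 1 + ∑ j, (f.trees j).deg := by
  rw [toTerm, Term.deg_node]
  congr 1
  exact Finset.sum_congr rfl fun j _ => Term.deg_lift _

theorem numLeaves_toTerm (f : Forest ar) : f.toTerm.numLeaves = ∑ j, (f.trees j).numLeaves := by
  rw [toTerm, Term.numLeaves_node]
  exact Finset.sum_congr rfl fun j _ => Term.numLeaves_lift _

theorem preorder_toTerm (f : Forest ar) : f.toTerm.preorder =
    some (Sum.inr f.n) :: ((List.ofFn f.trees).map fun t => t.lift.preorder).flatten := by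
  rw [toTerm, Term.preorder, List.map_ofFn]
  rfl

theorem toTerm_injective : Function.Injective (toTerm : Forest ar → Term (forestArity ar)) := by
  rintro ⟨n, t⟩ ⟨n', t'⟩ h
  simp only [toTerm, Term.node.injEq, Sum.inr.injEq] at h
  obtain ⟨rfl, h⟩ := h
  congr 1
  funext j
  exact Term.lift_injective (congrFun (eq_of_heq h) j)

theorem takeWhile_append_some {α : Type*} (l : List (Option α)) (x : α) :
    (l ++ [some x]).takeWhile Option.isNone = l.takeWhile Option.isNone := by
  induction l with
  | nil => simp
  | cons o l ih => cases o <;> simp [ih]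

/-- The preorder traversal of the forest without its root. -/
def body (f : Forest ar) : List (Option (S ⊕ ℕ)) :=
  ((List.ofFn f.trees).map fun t => t.lift.preorder).flatten

theorem numExtreme_toTerm (f : Forest ar) :
    f.toTerm.numExtreme = (f.body.reverse.takeWhile Option.isNone).length := by
  rw [Term.numExtreme, preorder_toTerm, List.reverse_cons, takeWhile_append_some]
  rfl

theorem takeWhile_replicate_append {α : Type*} (m : ℕ) (l : List (Option α)) :
    ((List.replicate m none ++ l).takeWhile Option.isNone).length
      = m + (l.takeWhile Option.isNone).length := by
  induction m with
  | zero => simp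
  | succ m ih =>
    rw [List.replicate_succ, List.cons_append, List.takeWhile_cons_of_pos rfl, List.length_cons, ih]
    omega

theorem flatten_replicate_leaf (m : ℕ) :
    ((List.replicate m (Term.leaf : Term ar)).map fun t => t.lift.preorder).flatten
      = List.replicate m none := by
  induction m with
  | zero => rfl
  | succ m ih =>
    rw [List.replicate_succ, List.map_cons, List.flatten_cons, ih, List.replicate_succ]
    rfl

theorem numExtreme_concat_corolla (f : Forest ar) (m : ℕ) :
    (f.concat (corolla m)).toTerm.numExtreme = f.toTerm.numExtreme + m := by
  have : (f.concat (corolla m)).body = f.body ++ List.replicate m none := by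
    rw [body, concat]
    simp only [List.ofFn_fin_append, corolla, List.map_append, List.flatten_append,
      List.ofFn_const, flatten_replicate_leaf]
    rfl
  rw [numExtreme_toTerm, numExtreme_toTerm, this, List.reverse_append, List.reverse_replicate,
    takeWhile_replicate_append, add_comm]

theorem numExtreme_le (f : Forest ar) : f.toTerm.numExtreme ≤ f.toTerm.numLeaves := by
  rw [Term.numExtreme, Term.numLeaves, ← List.countP_reverse]
  have h : ∀ l : List (Option (S ⊕ ℕ)),
      (l.takeWhile Option.isNone).length ≤ l.countP Option.isNone := by
    intro l
    induction l with
    | nil => simp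
    | cons o l ih => cases o <;> simp [ih]
  exact h _

theorem IsRootTilted.drop_eq {f : Forest ar} (hf : f.IsRootTilted) (j : Fin f.n)
    (hj : f.trees j = .leaf) :
    (List.ofFn f.trees).drop j = List.replicate (f.n - j) Term.leaf := by
  refine List.eq_replicate_iff.2 ⟨by simp, fun t ht => ?_⟩
  obtain ⟨i, hi, rfl⟩ := List.mem_iff_getElem.1 ht
  have hi' : (j : ℕ) + i < f.n := by
    simp only [List.length_drop, List.length_ofFn] at hi
    omega
  rw [List.getElem_drop, List.getElem_ofFn]
  rcases Nat.eq_zero_or_pos i with rfl | h0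
  · exact hj
  · exact hf j ⟨j + i, hi'⟩ (Fin.lt_def.2 (by simp; omega)) hj

theorem IsRootTilted.le_numExtreme {f : Forest ar} (hf : f.IsRootTilted) (j : Fin f.n)
    (hj : f.trees j = .leaf) : f.n - j ≤ f.toTerm.numExtreme := by
  have : f.body = (((List.ofFn f.trees).take j).map fun t => t.lift.preorder).flatten
      ++ List.replicate (f.n - j) none := by
    rw [← flatten_replicate_leaf (ar := ar), ← hf.drop_eq j hj, ← List.flatten_append,
      ← List.map_append, List.take_append_drop]
    rfl
  rw [numExtreme_toTerm, this, List.reverse_append, List.reverse_replicate,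
    takeWhile_replicate_append]
  omega

theorem IsRootTilted.numLeaves_eq {f : Forest ar} (hf : f.IsRootTilted) (j : Fin f.n)
    (hj : f.trees j = .leaf) :
    f.toTerm.numLeaves = ∑ i ∈ Finset.Iio j, (f.trees i).numLeaves + (f.n - j) := by
  have h1 : ∀ i, ¬ i < j → (f.trees i).numLeaves = 1 := by
    intro i hi
    have : f.trees i = .leaf := by
      rcases (not_lt.1 hi).eq_or_lt with rfl | h
      · exact hj
      · exact hf j i h hj
    rw [this]
    rfl
  rw [numLeaves_toTerm, ← Finset.sum_filter_add_sum_filter_not Finset.univ (fun i => i < j)]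
  congr 1
  · exact Finset.sum_congr (by ext; simp) fun _ _ => rfl
  · rw [Finset.sum_congr rfl fun i hi => h1 i (Finset.mem_filter.1 hi).2]
    have : Finset.univ.filter (fun i => ¬ i < j) = Finset.Ici j := by ext; simp
    rw [this, Finset.sum_const, Fin.card_Ici, smul_eq_mul, mul_one]

theorem IsRootTilted.concat_corolla {f : Forest ar} (hf : f.IsRootTilted) (m : ℕ) :
    (f.concat (corolla m)).IsRootTilted := by
  intro i j
  change Fin (f.n + m) at i j
  change i < j → Fin.append f.trees (fun _ : Fin m => Term.leaf) i = _ →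
    Fin.append f.trees (fun _ : Fin m => Term.leaf) j = _
  induction j using Fin.addCases with
  | right j => intros; simp
  | left j =>
    induction i using Fin.addCases with
    | left i =>
      intro h h'
      rw [Fin.append_left] at h' ⊢
      exact hf i j (Fin.lt_def.2 (Fin.lt_def.1 h)) h'
    | right i =>
      intro h
      have := Fin.lt_def.1 h
      simp at this
      omega

theorem sum_deg_concat_corolla (f : Forest ar) (m : ℕ) :
    ∑ j, ((f.concat (corolla m)).trees j).deg = ∑ j, (f.trees j).deg := by
  change ∑ j : Fin (f.n + m), (Fin.append f.trees (fun _ : Fin m => Term.leaf) j).deg = _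
  rw [Fin.sum_univ_add]
  simp [Term.deg_leaf]

theorem sum_deg_graftExtreme (g h : Forest ar) (hn : h.n = g.toTerm.numExtreme) :
    ∑ j, ((g.graftExtreme h).trees j).deg
      = ∑ j, (g.trees j).deg + ∑ j, (h.trees j).deg := by
  have hle := g.numExtreme_le
  simp only [graftExtreme, leafSubst, Term.deg_leafSubst, Finset.sum_add_distrib]
  congr 1
  have key := Term.sum_range_blocks (fun j => (g.trees j).numLeaves) (fun i => Term.deg
    (if hi : g.toTerm.numLeaves - g.toTerm.numExtreme ≤ i ∧
        i - (g.toTerm.numLeaves - g.toTerm.numExtreme) < h.n then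
      h.trees ⟨i - (g.toTerm.numLeaves - g.toTerm.numExtreme), hi.2⟩
    else .leaf)) 0
  simp only [zero_add] at key
  refine key.trans ?_
  rw [← numLeaves_toTerm]
  generalize hm : g.toTerm.numLeaves - g.toTerm.numExtreme = m
  have hL : g.toTerm.numLeaves = m + h.n := by omega
  rw [hL, Finset.sum_range_add, Finset.sum_eq_zero, zero_add, Finset.sum_range]
  · refine Finset.sum_congr rfl fun j _ => ?_
    simp
  · intro i hi
    rw [dif_neg (by have := Finset.mem_range.1 hi; omega)]
    rfl

theorem isRootTilted_graftExtreme (g h : Forest ar) (hn : h.n = g.toTerm.numExtreme)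
    (hg : g.IsRootTilted) (hh : h.IsRootTilted) : (g.graftExtreme h).IsRootTilted := by
  intro i j hij hi
  change Fin g.n at i j
  have hle := g.numExtreme_le
  have hil : g.trees i = .leaf := by
    by_contra hne
    cases ht : g.trees i with
    | leaf => exact hne ht
    | node s c =>
      simp [graftExtreme, leafSubst, ht, Term.leafSubst] at hi
  have hjl := hg i j hij hil
  have ei := hg.numLeaves_eq i hil
  have ej := hg.numLeaves_eq j hjl
  have li := hg.le_numExtreme i hil
  have lj := hg.le_numExtreme j hjl
  have hij' : (i : ℕ) < (j : ℕ) := hij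
  have hib : (i : ℕ) < g.n := i.isLt
  have hjb : (j : ℕ) < g.n := j.isLt
  simp only [graftExtreme, leafSubst, hil, hjl, Term.leafSubst] at hi ⊢
  rw [dif_pos (by constructor <;> omega)] at hi
  rw [dif_pos (by constructor <;> omega)]
  refine hh _ _ (Fin.lt_def.2 ?_) hi
  simp only
  omega

theorem IsLeaning.under {f₁ f₂ : Forest ar} (h₁ : f₁.IsLeaning) (h₂ : f₂.IsLeaning) :
    (f₁.under f₂).IsLeaning := by
  have hn : (f₂.concat (corolla f₁.toTerm.numExtreme)).n
      = (f₁.concat (corolla f₂.n)).toTerm.numExtreme := by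
    rw [numExtreme_concat_corolla, add_comm]
    rfl
  refine ⟨?_, isRootTilted_graftExtreme _ _ hn (h₁.2.concat_corolla _) (h₂.2.concat_corolla _)⟩
  have e₁ := h₁.1
  have e₂ := h₂.1
  rw [IsBalanced, deg_toTerm] at e₁ e₂ ⊢
  rw [Forest.under, sum_deg_graftExtreme _ _ hn, sum_deg_concat_corolla, sum_deg_concat_corolla]
  change _ = f₁.n + f₂.n + 1
  omega

end Forest

/-- The set of leaning forests. -/
def LeaningForest {S : Type u} (ar : S → ℕ) : Type u := {f : Forest ar // f.IsLeaning}

namespace LeaningForest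

variable {S : Type u} {ar : S → ℕ}

/-- The easterly wind order on leaning forests, seen as terms on `S ⊔ ℕ`. -/
instance instPreorder : Preorder (LeaningForest ar) := Preorder.lift fun f => f.1.toTerm

noncomputable instance instDecidableEq : DecidableEq (LeaningForest ar) := Classical.decEq _

noncomputable instance instDecidableLE : DecidableLE (LeaningForest ar) := Classical.decRel _

/-- The under operation on leaning forests. -/
def under (f₁ f₂ : LeaningForest ar) : LeaningForest ar := ⟨f₁.1.under f₂.1, f₁.2.under f₂.2⟩

theorem finite_setOf_dc_eq (w : List (S ⊕ ℕ)) :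
    {f : LeaningForest ar | f.1.toTerm.dc = w}.Finite :=
  (Term.finite_setOf_dc_eq w).preimage
    (f := fun f : LeaningForest ar => f.1.toTerm)
    (Forest.toTerm_injective.comp Subtype.val_injective).injOn

theorem finite_Ici (f : LeaningForest ar) : (Set.Ici f).Finite :=
  (finite_setOf_dc_eq f.1.toTerm.dc).subset fun _ h => h.1.symm

theorem finite_Iic (f : LeaningForest ar) : (Set.Iic f).Finite :=
  (finite_setOf_dc_eq f.1.toTerm.dc).subset fun _ h => h.1

noncomputable instance instLocallyFiniteOrder : LocallyFiniteOrder (LeaningForest ar) :=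
  LocallyFiniteOrder.ofFiniteIcc fun f _ => (finite_Ici f).subset fun _ h => h.1

noncomputable instance instLocallyFiniteOrderTop : LocallyFiniteOrderTop (LeaningForest ar) :=
  LocallyFiniteOrderTop.ofIci' _ (fun f => (finite_Ici f).toFinset) (by simp)

noncomputable instance instLocallyFiniteOrderBot : LocallyFiniteOrderBot (LeaningForest ar) :=
  LocallyFiniteOrderBot.ofIic' _ (fun f => (finite_Iic f).toFinset) (by simp)

/-- The word of terms different from the leaf identified with a leaning forest: its child subterms
at the root which are not leaves, from left to right. -/
def word (f : LeaningForest ar) : FreeMonoid {t : Term ar // t ≠ .leaf} :=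
  FreeMonoid.ofList ((List.ofFn f.1.trees).filterMap fun t =>
    if h : t ≠ .leaf then some ⟨t, h⟩ else none)

end LeaningForest

/-- The algebra underlying the natural Hopf algebra of the free operad on `S`: the vector space
spanned by the words on the terms different from the unit (the leaf), the product of two basis
elements being given by concatenation. -/
abbrev NaturalAlgebra (K : Type v) [Field K] {S : Type u} (ar : S → ℕ) : Type (max u v) :=
  MonoidAlgebra K (FreeMonoid {t : Term ar // t ≠ .leaf})

section Bases

variable (K : Type v) [Field K] {S : Type u} {ar : S → ℕ}

/-- The elementary basis, indexed by leaning forests. -/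
noncomputable def basisE (f : LeaningForest ar) : NaturalAlgebra K ar :=
  MonoidAlgebra.of K _ f.word

/-- The fundamental basis: the sum of `μ(f, f') E_{f'}` over the leaning forests `f' ≥ f`, where `μ`
is the Möbius function. -/
noncomputable def basisF (f : LeaningForest ar) : NaturalAlgebra K ar :=
  ∑ f' ∈ Finset.Ici f, IncidenceAlgebra.mu K f f' • basisE K f'

/-- The homogeneous basis: the sum of `F_{f'}` over the leaning forests `f' ≤ f`. -/
noncomputable def basisH (f : LeaningForest ar) : NaturalAlgebra K ar :=
  ∑ f' ∈ Finset.Iic f, basisF K f'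

end Bases

end EasterlyWind

/-! In the basis `E` the product is concatenation, so the theorem is a statement about the poset of
leaning forests. Such a forest is encoded by a word `code`: its nodes other than the root, in
preorder, each with its decoration and its slot, a pair (parent, position). All the children of the
root share the slot `(1, 0)`: tilting fixes their positions, and balance fixes the number of leaves
at the root. Slots are ordered by parent, then by decreasing position. Since the letters of the
connection word at a parent `p` other than the root lie in `[p, p + 1)`, the easterly wind order
becomes the letterwise comparison of codes (`toTerm_le_toTerm_iff`). The codes are the words
satisfying `IsValid`: each node is put at the root or at a free slot `e`, and this closes all the
slots which are not strictly below `e`.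

Cutting a code after `n` letters yields two codes, those of `initial` and `final`. When `n` is the
size of `f₁`, the cut has an adjoint on each side. The lowest gluing of `f₁` and `f₂` leaves the
root children of `f₂` at the root: this is `juxtapose`, which carries the product of the `E`
(`juxtapose_le_iff`). The highest gluing puts them successively at the free slots of `f₁`, in
decreasing order: this is `under` (`le_under_iff`).

By Möbius inversion, `E_f` is the sum of the `F_g` for `g ≥ f`. Hence `E_{f₁} E_{f₂}` splits along
the fibres of the cut, and induction on the upper sets gives `F_{f₁} F_{f₂}` as the sum of `F` over
one fibre (`basisF_mul_basisF`). Summing over `g₁ ≤ f₁` and `g₂ ≤ f₂` collects the forests whose two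
parts are below `f₁` and `f₂`, i.e. those below `f₁.under f₂`. -/

namespace EasterlyWind

/-! ### Words of decorated slots

A slot `(p, l)` is the `l`-th position among the children of the node number `p ≥ 2`. The slot
`(1, 0)` stands for the first free position among the children of the root of a forest. -/

section Words

variable {S : Type u}

/-- The order on slots: later parents are larger, and positions are reversed. -/
def SlotLE (e e' : ℕ × ℕ) : Prop := e.1 < e'.1 ∨ e.1 = e'.1 ∧ e'.2 ≤ e.2

/-- The strict order on slots. -/
def SlotLT (e e' : ℕ × ℕ) : Prop := e.1 < e'.1 ∨ e.1 = e'.1 ∧ e'.2 < e.2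

instance decidableSlotLT (e e' : ℕ × ℕ) : Decidable (SlotLT e e') :=
  inferInstanceAs (Decidable (_ ∨ _))

/-- The slots of a new node numbered `k` of arity `a`. -/
def newSlots (k a : ℕ) : List (ℕ × ℕ) := List.ofFn fun j : Fin a => (k, (j : ℕ) + 1)

theorem mem_newSlots {k a : ℕ} {e : ℕ × ℕ} :
    e ∈ newSlots k a ↔ e.1 = k ∧ 1 ≤ e.2 ∧ e.2 ≤ a := by
  rw [newSlots, List.mem_ofFn']
  constructor
  · rintro ⟨j, rfl⟩
    exact ⟨rfl, Nat.le_add_left _ _, j.isLt⟩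
  · rintro ⟨rfl, h1, h2⟩
    exact ⟨⟨e.2 - 1, by omega⟩, Prod.ext rfl (by simp only; omega)⟩

/-- The stack of the free slots after a node numbered `k` of arity `a` has been put at the
slot `e`. -/
def push (k a : ℕ) (e : ℕ × ℕ) (σ : List (ℕ × ℕ)) : List (ℕ × ℕ) :=
  newSlots k a ++ σ.filter fun x => SlotLT x e

theorem mem_push {k a : ℕ} {e x : ℕ × ℕ} {σ : List (ℕ × ℕ)} :
    x ∈ push k a e σ ↔ (x.1 = k ∧ 1 ≤ x.2 ∧ x.2 ≤ a) ∨ x ∈ σ ∧ SlotLT x e := by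
  simp [push, mem_newSlots]

/-- A stack of slots of nodes smaller than `k`, in decreasing order. -/
def IsStack (k : ℕ) (σ : List (ℕ × ℕ)) : Prop :=
  σ.Pairwise (fun x y => SlotLT y x) ∧ ∀ e ∈ σ, 2 ≤ e.1 ∧ e.1 < k

theorem isStack_nil (k : ℕ) : IsStack k [] := ⟨List.Pairwise.nil, by simp⟩

theorem IsStack.tail {k : ℕ} {σ : List (ℕ × ℕ)} (h : IsStack k σ) : IsStack k σ.tail :=
  ⟨h.1.tail, fun x hx => h.2 x (List.mem_of_mem_tail hx)⟩

theorem isStack_push {k : ℕ} (hk : 2 ≤ k) (a : ℕ) (e : ℕ × ℕ) {σ : List (ℕ × ℕ)}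
    (h : IsStack k σ) : IsStack (k + 1) (push k a e σ) := by
  refine ⟨List.pairwise_append.2 ⟨?_, h.1.filter _, ?_⟩, ?_⟩
  · rw [newSlots, List.pairwise_ofFn]
    intro i j hij
    exact Or.inr ⟨rfl, by have := Fin.lt_def.1 hij; simp only; omega⟩
  · intro x hx y hy
    have h1 := mem_newSlots.1 hx
    have h2 := h.2 y (List.mem_of_mem_filter hy)
    exact Or.inl (by omega)
  · intro x hx
    rcases mem_push.1 hx with h1 | ⟨h1, -⟩
    · omega
    · have := h.2 x h1
      omega

/-- The words describing the successive insertions of nodes numbered `k, k + 1, …` in the free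
slots, starting with the stack `σ`. -/
def IsValid (ar : S → ℕ) : ℕ → List (ℕ × ℕ) → List (S × ℕ × ℕ) → Prop
  | _, _, [] => True
  | k, σ, (s, e) :: w => (e = (1, 0) ∨ e ∈ σ) ∧ IsValid ar (k + 1) (push k (ar s) e σ) w

/-- The stack of the free slots after the insertion of the nodes of a word. -/
def finalStack (ar : S → ℕ) : ℕ → List (ℕ × ℕ) → List (S × ℕ × ℕ) → List (ℕ × ℕ)
  | _, σ, [] => σ
  | k, σ, (s, e) :: w => finalStack ar (k + 1) (push k (ar s) e σ) w

variable {ar : S → ℕ}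

theorem isStack_finalStack (w : List (S × ℕ × ℕ)) {k : ℕ} (hk : 2 ≤ k) {σ : List (ℕ × ℕ)}
    (h : IsStack k σ) : IsStack (k + w.length) (finalStack ar k σ w) := by
  induction w generalizing k σ with
  | nil => exact h
  | cons x w ih =>
    have := ih (by omega) (isStack_push hk (ar x.1) x.2 h)
    rw [List.length_cons, ← add_assoc, add_right_comm]
    exact this

theorem isValid_append {w w' : List (S × ℕ × ℕ)} {k : ℕ} {σ : List (ℕ × ℕ)} :
    IsValid ar k σ (w ++ w') ↔
      IsValid ar k σ w ∧ IsValid ar (k + w.length) (finalStack ar k σ w) w' := by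
  induction w generalizing k σ with
  | nil => simp [IsValid, finalStack]
  | cons x w ih =>
    simp only [List.cons_append, IsValid, finalStack, ih, List.length_cons, and_assoc]
    rw [show k + 1 + w.length = k + (w.length + 1) by omega]

/-- Same decorations and letterwise comparison of the slots. -/
def WordLE (w w' : List (S × ℕ × ℕ)) : Prop :=
  List.Forall₂ (fun x y => x.1 = y.1 ∧ SlotLE x.2 y.2) w w'

theorem SlotLE.antisymm {e e' : ℕ × ℕ} (h : SlotLE e e') (h' : SlotLE e' e) : e = e' := by
  unfold SlotLE at h h'
  exact Prod.ext (by omega) (by omega)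

theorem WordLE.antisymm {w w' : List (S × ℕ × ℕ)} (h : WordLE w w') (h' : WordLE w' w) :
    w = w' := by
  induction h with
  | nil => rfl
  | cons h1 _ ih =>
    obtain ⟨h2, h3⟩ := List.forall₂_cons.1 h'
    rw [ih h3, Prod.ext h1.1 (h1.2.antisymm h2.2)]

/-- A node put at a lower slot closes more of the old slots, and it opens the same new ones because
its decoration is the same. -/
theorem finalStack_sublist {w w' : List (S × ℕ × ℕ)} (h : WordLE w w') (k : ℕ)
    {σ σ' : List (ℕ × ℕ)} (hσ : σ.Sublist σ') :
    (finalStack ar k σ w).Sublist (finalStack ar k σ' w') := by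
  induction h generalizing k σ σ' with
  | nil => exact hσ
  | @cons x y w w' h1 _ ih =>
    obtain ⟨s, e⟩ := x
    obtain ⟨s', e'⟩ := y
    obtain ⟨h1, h2⟩ := h1
    simp only at h1 h2
    subst h1
    refine ih _ (List.Sublist.append_left ((hσ.filter _).trans ?_) _)
    refine List.monotone_filter_right _ fun x hx => ?_
    simp only [decide_eq_true_eq] at hx ⊢
    unfold SlotLE at h2
    unfold SlotLT at hx ⊢
    omega

/-- Each slot of the word is `(1, 0)` or a slot of a node of number at least `2`. -/
def IsNormal (w : List (S × ℕ × ℕ)) : Prop := ∀ x ∈ w, x.2 = (1, 0) ∨ 2 ≤ x.2.1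

theorem IsValid.isNormal {w : List (S × ℕ × ℕ)} {k : ℕ} (hk : 2 ≤ k) {σ : List (ℕ × ℕ)}
    (hσ : IsStack k σ) (h : IsValid ar k σ w) : IsNormal w := by
  induction w generalizing k σ with
  | nil => intro x hx; simp at hx
  | cons y w ih =>
    obtain ⟨s, e⟩ := y
    intro x hx
    rcases List.mem_cons.1 hx with rfl | hx
    · exact h.1.imp_right fun h => (hσ.2 _ h).1
    · exact ih (by omega) (isStack_push hk _ _ hσ) h.2 x hx

/-- This bound is what keeps a letter of the connection word at a parent `p ≥ 2` at least equal to
`p`. -/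
theorem IsValid.snd_le {w : List (S × ℕ × ℕ)} {k : ℕ} {σ : List (ℕ × ℕ)}
    (h : IsValid ar k σ w) (A : ℕ → ℕ) (hA : ∀ i (hi : i < w.length), A (k + i) = ar w[i].1)
    (hσ : ∀ e ∈ σ, e.2 ≤ A e.1) : ∀ x ∈ w, x.2 = (1, 0) ∨ x.2.2 ≤ A x.2.1 := by
  induction w generalizing k σ with
  | nil => intro x hx; simp at hx
  | cons y w ih =>
    obtain ⟨s, e⟩ := y
    have h0 : A k = ar s := hA 0 (by simp)
    intro x hx
    rcases List.mem_cons.1 hx with rfl | hx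
    · exact h.1.imp_right (hσ _)
    · refine ih h.2 (fun i hi => ?_) (fun e he => ?_) x hx
      · have := hA (i + 1) (by simpa using hi)
        rw [add_assoc, add_comm 1]
        simpa using this
      · rcases mem_push.1 he with h1 | h1
        · rw [h1.1, h0]
          exact h1.2.2
        · exact hσ e h1.1

/-! ### Cutting and gluing words -/

/-- Forget the first `m` nodes: the nodes which are attached to them become children of
the root. -/
def restrict (m : ℕ) (w : List (S × ℕ × ℕ)) : List (S × ℕ × ℕ) :=
  w.map fun x => (x.1, if x.2.1 ≤ m + 1 then (1, 0) else (x.2.1 - m, x.2.2))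

/-- The root has number `1`, so the first `m` nodes have numbers `2` to `m + 1`. An insertion at one
of them or at the root closes every slot of a later node, as does the insertion at the root that
replaces it. -/
theorem IsValid.restrict {w : List (S × ℕ × ℕ)} {k m : ℕ} (hk : 2 ≤ k) {σ σ' : List (ℕ × ℕ)}
    (hσ : ∀ e ∈ σ, m + 1 < e.1 → (e.1 - m, e.2) ∈ σ') (h : IsValid ar (k + m) σ w) :
    IsValid ar k σ' (restrict m w) := by
  induction w generalizing k σ σ' with
  | nil => trivial
  | cons y w ih =>
    obtain ⟨s, e⟩ := y
    obtain ⟨h1, h2⟩ := h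
    refine ⟨?_, ih (k := k + 1) (by omega) ?_ (by rwa [add_right_comm])⟩
    · simp only
      split_ifs with h3
      · exact Or.inl rfl
      · refine Or.inr (hσ e (h1.resolve_left ?_) (by omega))
        rintro rfl
        simp at h3
    · intro x hx hm
      rw [mem_push] at hx ⊢
      rcases hx with hx | ⟨hx, hlt⟩
      · left
        simp only
        omega
      · right
        refine ⟨hσ x hx hm, ?_⟩
        unfold SlotLT at hlt ⊢
        simp only
        split_ifs with h3
        · omega
        · simp only
          omega

/-- Shift by `m` the numbers of the nodes of a word, the children of the root being put at the
slots of `τ` and then at the root. -/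
def attach (m : ℕ) : List (ℕ × ℕ) → List (S × ℕ × ℕ) → List (S × ℕ × ℕ)
  | _, [] => []
  | τ, (s, e) :: w =>
    if e.1 ≤ 1 then (s, τ.headD (1, 0)) :: attach m τ.tail w
    else (s, e.1 + m, e.2) :: attach m τ w

theorem attach_eq_map_append {m : ℕ} {w w' : List (S × ℕ × ℕ)} (h : ∀ x ∈ w, 1 < x.2.1)
    (τ : List (ℕ × ℕ)) :
    attach m τ (w ++ w') = w.map (fun x => (x.1, x.2.1 + m, x.2.2)) ++ attach m τ w' := by
  induction w with
  | nil => rfl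
  | cons x w ih =>
    obtain ⟨s, e⟩ := x
    have := h (s, e) (by simp)
    rw [List.cons_append, attach, if_neg (by simp only at this; omega),
      ih fun x hx => h x (List.mem_cons_of_mem _ hx)]
    rfl

theorem restrict_attach {m : ℕ} {w : List (S × ℕ × ℕ)} (hw : IsNormal w) {τ : List (ℕ × ℕ)}
    (hτ : ∀ e ∈ τ, e.1 ≤ m + 1) : restrict m (attach m τ w) = w := by
  induction w generalizing τ with
  | nil => rfl
  | cons y w ih =>
    obtain ⟨s, e⟩ := y
    have hw' : IsNormal w := fun x hx => hw x (List.mem_cons_of_mem _ hx)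
    have h1 : e = (1, 0) ∨ 2 ≤ e.1 := hw (s, e) (by simp)
    rw [attach]
    split_ifs with h
    · have h2 : e = (1, 0) := h1.resolve_right (by omega)
      have h3 : (τ.headD (1, 0)).1 ≤ m + 1 := by
        cases τ with
        | nil => simp
        | cons e τ => exact hτ e (by simp)
      have h4 := ih hw' (τ := τ.tail) fun e he => hτ e (List.mem_of_mem_tail he)
      rw [restrict] at h4 ⊢
      rw [List.map_cons, h4, h2]
      simp only [if_pos h3]
    · have h4 := ih hw' hτ
      rw [restrict] at h4 ⊢
      rw [List.map_cons, h4]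
      simp only
      rw [if_neg (by omega), Nat.add_sub_cancel]

/-- The slots of the forgotten nodes collapse to one slot, below all the others, and the others are
shifted uniformly. -/
theorem WordLE.restrict {w w' : List (S × ℕ × ℕ)} (h : WordLE w w') (m : ℕ) :
    WordLE (restrict m w) (restrict m w') := by
  refine List.forall₂_map_left_iff.2 (List.forall₂_map_right_iff.2 (h.imp ?_))
  intro x y hxy
  refine ⟨hxy.1, ?_⟩
  have := hxy.2
  unfold SlotLE at this ⊢
  split_ifs <;> first | exact Or.inr ⟨rfl, le_rfl⟩ | (simp only; omega)

/-- `(1, 0)` is the least slot that a normal word can use, so leaving the root children at the root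
is the lowest way to undo `restrict`. -/
theorem attach_nil_le {m : ℕ} {w w' : List (S × ℕ × ℕ)} (hw' : IsNormal w')
    (h : WordLE w (restrict m w')) : WordLE (attach m [] w) w' := by
  induction w' generalizing w with
  | nil =>
    rw [List.forall₂_nil_right_iff.1 h]
    exact List.Forall₂.nil
  | cons y w' ih =>
    obtain ⟨s', e'⟩ := y
    cases h with
    | @cons x _ w _ h1 h2 =>
      obtain ⟨s, e⟩ := x
      have h3 : e' = (1, 0) ∨ 2 ≤ e'.1 := hw' (s', e') (by simp)
      have h4 := ih (fun x hx => hw' x (List.mem_cons_of_mem _ hx)) h2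
      obtain ⟨h5, h6⟩ := h1
      rw [attach]
      split_ifs with h
      · refine List.Forall₂.cons ⟨h5, ?_⟩ h4
        rcases h3 with rfl | h3
        · exact Or.inr ⟨rfl, le_rfl⟩
        · exact Or.inl h3
      · refine List.Forall₂.cons ⟨h5, ?_⟩ h4
        unfold SlotLE at h6 ⊢
        simp only at h6 ⊢
        split_ifs at h6 with h7
        · simp only at h6
          omega
        · simp only at h6
          omega

/-- A slot strictly below `e` cannot be the head of `τ`, which is at least `e`. -/
theorem sublist_tail_of_filter {σ τ : List (ℕ × ℕ)} {e : ℕ × ℕ} (h : σ.Sublist τ)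
    (hτ : τ.Pairwise (fun x y => SlotLT y x)) (he : SlotLE e (τ.headD (1, 0))) :
    (σ.filter fun x => SlotLT x e).Sublist τ.tail := by
  cases τ with
  | nil => rw [List.sublist_nil.1 h]; exact List.Sublist.refl _
  | cons x τ =>
    refine (h.filter _).trans ?_
    rw [List.filter_cons_of_neg]
    · exact List.filter_sublist
    · simp only [List.headD_cons] at he
      unfold SlotLE at he
      rw [decide_eq_true_eq]
      unfold SlotLT
      omega

/-- Always taking the highest slot of `τ` is optimal. The invariant is that the slots of the first
`m` nodes still free for `w` form a sublist of `τ`: each time `attach` uses up the head of `τ`, the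
word `w` closes at least that slot, if it was still free. -/
theorem le_attach {m k : ℕ} (hk : 2 ≤ k) {w w' : List (S × ℕ × ℕ)} {σ τ : List (ℕ × ℕ)}
    (hw : IsValid ar (k + m) σ w) (hτ : IsStack (m + 2) τ)
    (hστ : (σ.filter fun x => x.1 ≤ m + 1).Sublist τ)
    (h : WordLE (restrict m w) w') : WordLE w (attach m τ w') := by
  induction w generalizing k σ τ w' with
  | nil =>
    rw [List.forall₂_nil_left_iff.1 h]
    exact List.Forall₂.nil
  | cons y w ih =>
    obtain ⟨s, e⟩ := y
    obtain ⟨hw1, hw2⟩ := hw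
    -- The slots opened by `push` belong to the node `k + m ≥ m + 2`.
    have hfilter : (push (k + m) (ar s) e σ).filter (fun x => x.1 ≤ m + 1)
        = (σ.filter fun x => x.1 ≤ m + 1).filter fun x => SlotLT x e := by
      rw [push, List.filter_append, List.filter_eq_nil_iff.2, List.nil_append, List.filter_comm]
      intro x hx
      have := mem_newSlots.1 hx
      simp only [decide_eq_true_eq]
      omega
    cases h with
    | @cons _ x _ w' h1 h2 =>
      obtain ⟨s', e'⟩ := x
      obtain ⟨h5, h6⟩ := h1
      have hw3 : IsValid ar (k + 1 + m) (push (k + m) (ar s) e σ) w := by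
        rwa [add_right_comm]
      rw [attach]
      simp only at h5 h6
      split_ifs with h
      · have h7 : e.1 ≤ m + 1 := by
          by_contra h7
          rw [if_neg h7] at h6
          unfold SlotLE at h6
          simp only at h6
          omega
        -- Here `e` is the root slot or a member of `τ`, whose greatest element is its head.
        have h8 : SlotLE e (τ.headD (1, 0)) := by
          rcases hw1 with rfl | hw1
          · cases τ with
            | nil => exact Or.inr ⟨rfl, le_rfl⟩
            | cons x τ =>
              exact Or.inl (hτ.2 x (by simp)).1
          · have h9 : e ∈ τ := hστ.subset (by simp [hw1, h7])
            cases τ with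
            | nil => simp at h9
            | cons x τ =>
              rcases List.mem_cons.1 h9 with rfl | h9
              · exact Or.inr ⟨rfl, le_rfl⟩
              · have := (List.pairwise_cons.1 hτ.1).1 e h9
                unfold SlotLT at this
                unfold SlotLE
                simp only [List.headD_cons]
                omega
        refine List.Forall₂.cons ⟨h5, h8⟩ (ih (by omega) hw3 hτ.tail ?_ h2)
        rw [hfilter]
        exact sublist_tail_of_filter hστ hτ.1 h8
      · refine List.Forall₂.cons ⟨h5, ?_⟩ (ih (by omega) hw3 hτ ?_ h2)
        · unfold SlotLE at h6 ⊢
          simp only at h6 ⊢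
          split_ifs at h6 with h7
          · simp only at h6
            omega
          · simp only at h6
            omega
        · rw [hfilter]
          exact List.filter_sublist.trans hστ

/-! ### The two adjunctions for words -/

theorem WordLE.length_eq {w w' : List (S × ℕ × ℕ)} (h : WordLE w w') : w.length = w'.length :=
  List.Forall₂.length_eq h

theorem WordLE.append {w₁ w₂ w₁' w₂' : List (S × ℕ × ℕ)} (h₁ : WordLE w₁ w₁')
    (h₂ : WordLE w₂ w₂') : WordLE (w₁ ++ w₂) (w₁' ++ w₂') :=
  List.rel_append h₁ h₂

theorem IsNormal.drop {w : List (S × ℕ × ℕ)} (h : IsNormal w) (n : ℕ) : IsNormal (w.drop n) :=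
  fun x hx => h x (List.mem_of_mem_drop hx)

theorem append_attach_nil_le_iff {w₁ w₂ w : List (S × ℕ × ℕ)} (h₂ : IsNormal w₂)
    (hw : IsNormal w) :
    WordLE (w₁ ++ attach w₁.length [] w₂) w ↔
      WordLE w₁ (w.take w₁.length) ∧ WordLE w₂ (restrict w₁.length (w.drop w₁.length)) := by
  constructor
  · intro h
    have h1 := List.forall₂_take w₁.length h
    have h2 := WordLE.restrict (List.forall₂_drop w₁.length h) w₁.length
    rw [List.take_left] at h1
    rw [List.drop_left, restrict_attach h₂ (by simp)] at h2
    exact ⟨h1, h2⟩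
  · rintro ⟨h1, h2⟩
    rw [← List.take_append_drop w₁.length w]
    exact h1.append (attach_nil_le (hw.drop _) h2)

/-- Validity of `w` matters here: once its first part is below `w₁`, it leaves free only slots that
`w₁` also leaves free, by `finalStack_sublist`, and the invariant of `le_attach` starts. -/
theorem le_append_attach_iff {w₁ w₂ w : List (S × ℕ × ℕ)} (h₂ : IsNormal w₂)
    (hw : IsValid ar 2 [] w) :
    WordLE w (w₁ ++ attach w₁.length (finalStack ar 2 [] w₁) w₂) ↔
      WordLE (w.take w₁.length) w₁ ∧ WordLE (restrict w₁.length (w.drop w₁.length)) w₂ := by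
  have hτ : IsStack (w₁.length + 2) (finalStack ar 2 [] w₁) := by
    rw [add_comm]
    exact isStack_finalStack w₁ le_rfl (isStack_nil 2)
  constructor
  · intro h
    have h1 := List.forall₂_take w₁.length h
    have h2 := WordLE.restrict (List.forall₂_drop w₁.length h) w₁.length
    rw [List.take_left] at h1
    rw [List.drop_left, restrict_attach h₂ fun e he => by have := hτ.2 e he; omega] at h2
    exact ⟨h1, h2⟩
  · rintro ⟨h1, h2⟩
    have hlen := h1.length_eq
    have hw' := hw
    rw [← List.take_append_drop w₁.length w, isValid_append, hlen] at hw'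
    have := h1.append (le_attach le_rfl hw'.2 hτ
      (List.filter_sublist.trans (finalStack_sublist h1 2 (List.Sublist.refl []))) h2)
    rwa [List.take_append_drop] at this

end Words

/-! ### Words of lists of terms placed at slots -/

theorem sum_Iio_succ {n : ℕ} (a : Fin (n + 1) → ℕ) (j : Fin n) :
    ∑ i ∈ Finset.Iio j.succ, a i = a 0 + ∑ i ∈ Finset.Iio j, a i.succ := by
  have h : ∀ {m : ℕ} (b : Fin m → ℕ) (j : Fin m),
      ∑ i ∈ Finset.Iio j, b i = ∑ i, if i < j then b i else 0 := by
    intro m b j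
    rw [← Finset.sum_filter]
    exact Finset.sum_congr (by ext; simp) fun _ _ => rfl
  rw [h, h, Fin.sum_univ_succ, if_pos (Fin.succ_pos j)]
  simp only [Fin.succ_lt_succ_iff]

section Placed

variable {S : Type u} {ar : S → ℕ}

open Term

/-- The children of a node numbered `k`, with their slots. -/
def kids (k : ℕ) {a : ℕ} (c : Fin a → Term ar) : List ((ℕ × ℕ) × Term ar) :=
  List.ofFn fun j => ((k, (j : ℕ) + 1), c j)

theorem map_fst_kids (k : ℕ) {a : ℕ} (c : Fin a → Term ar) :
    (kids k c).map Prod.fst = newSlots k a := by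
  rw [kids, List.map_ofFn]
  rfl

theorem kids_injective (k : ℕ) {a : ℕ} :
    Function.Injective (kids k : (Fin a → Term ar) → List ((ℕ × ℕ) × Term ar)) := by
  intro c c' h
  have := List.ofFn_injective h
  funext j
  exact (Prod.ext_iff.1 (congrFun this j)).2

/-- Lists of terms placed at slots are built by adding a leaf or by joining in a node the terms
placed at its children. -/
theorem placed_induction {P : ℕ → List ((ℕ × ℕ) × Term ar) → Prop} (nil : ∀ k, P k [])
    (leaf : ∀ k e L, P k L → P k ((e, .leaf) :: L))
    (node : ∀ k e s c L, P (k + 1) (kids k c ++ L) → P k ((e, .node s c) :: L)) :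
    ∀ k L, P k L := by
  intro k L
  -- The measure counts all nodes and leaves; opening a node lowers it by exactly one.
  generalize hN : (L.map fun x => x.2.preorder.length).sum = N
  induction N using Nat.strong_induction_on generalizing k L with
  | _ N ih =>
    match L with
    | [] => exact nil k
    | (e, .leaf) :: L =>
      refine leaf k e L (ih _ ?_ k L rfl)
      rw [← hN, List.map_cons, List.sum_cons]
      simp [preorder]
    | (e, .node s c) :: L =>
      refine node k e s c L (ih _ ?_ (k + 1) _ rfl)
      rw [← hN, List.map_cons, List.sum_cons, List.map_append, List.sum_append, kids,
        List.map_ofFn]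
      refine Nat.add_lt_add_right ?_ _
      rw [preorder, List.length_cons, List.length_flatten, List.map_ofFn]
      exact Nat.lt_succ_self _

/-- The edges of terms placed at slots, their nodes being numbered `k, k + 1, …`. -/
def placedEdges : ℕ → List ((ℕ × ℕ) × Term ar) → List (ℕ × ℕ)
  | _, [] => []
  | k, (e, t) :: L => t.edgesFrom k e ++ placedEdges (k + t.deg) L

theorem placedEdges_ofFn_append {n : ℕ} (g : Fin n → ℕ × ℕ) (c : Fin n → Term ar)
    (L : List ((ℕ × ℕ) × Term ar)) (k : ℕ) :
    placedEdges k ((List.ofFn fun j => (g j, c j)) ++ L)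
      = (List.ofFn fun j =>
          (c j).edgesFrom (k + ∑ i ∈ Finset.Iio j, (c i).deg) (g j)).flatten
        ++ placedEdges (k + ∑ j, (c j).deg) L := by
  induction n generalizing k with
  | zero => simp
  | succ n ih =>
    rw [List.ofFn_succ, List.cons_append, placedEdges, ih, List.ofFn_succ, List.flatten_cons,
      List.append_assoc, Fin.sum_univ_succ]
    simp only [sum_Iio_succ, ← add_assoc]
    have : Finset.Iio (0 : Fin (n + 1)) = ∅ := by ext; simp
    rw [this, Finset.sum_empty, add_zero]

/-- Preorder as a traversal with an explicit stack: after a node is read, its children precede the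
terms still waiting. -/
theorem placedEdges_node (k : ℕ) (e : ℕ × ℕ) (s : S) (c : Fin (ar s) → Term ar)
    (L : List ((ℕ × ℕ) × Term ar)) :
    placedEdges k ((e, .node s c) :: L) = e :: placedEdges (k + 1) (kids k c ++ L) := by
  rw [kids, placedEdges_ofFn_append, placedEdges, edgesFrom, deg_node, ← add_assoc]
  rfl

/-- The decorations of placed terms. -/
def placedDc (L : List ((ℕ × ℕ) × Term ar)) : List S := L.flatMap fun x => x.2.dc

theorem placedDc_node (k : ℕ) (e : ℕ × ℕ) (s : S) (c : Fin (ar s) → Term ar)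
    (L : List ((ℕ × ℕ) × Term ar)) :
    placedDc ((e, .node s c) :: L) = s :: placedDc (kids k c ++ L) := by
  rw [placedDc, List.flatMap_cons, dc_node, placedDc, List.flatMap_append, List.cons_append]
  congr 2
  rw [List.flatMap_def, kids, List.map_ofFn]
  rfl

/-- The word of the nodes of placed terms, numbered `k, k + 1, …` in preorder. -/
def placedWord (k : ℕ) (L : List ((ℕ × ℕ) × Term ar)) : List (S × ℕ × ℕ) :=
  (placedDc L).zip (placedEdges k L)

theorem placedWord_nil (k : ℕ) : placedWord k ([] : List ((ℕ × ℕ) × Term ar)) = [] := rfl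

theorem placedWord_leaf (k : ℕ) (e : ℕ × ℕ) (L : List ((ℕ × ℕ) × Term ar)) :
    placedWord k ((e, .leaf) :: L) = placedWord k L := rfl

theorem placedWord_node (k : ℕ) (e : ℕ × ℕ) (s : S) (c : Fin (ar s) → Term ar)
    (L : List ((ℕ × ℕ) × Term ar)) :
    placedWord k ((e, .node s c) :: L) = (s, e) :: placedWord (k + 1) (kids k c ++ L) := by
  rw [placedWord, placedDc_node k, placedEdges_node, List.zip_cons_cons, placedWord]

theorem placedWord_of_leaves (k : ℕ) {L : List ((ℕ × ℕ) × Term ar)} (h : ∀ x ∈ L, x.2 = .leaf)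
    (L' : List ((ℕ × ℕ) × Term ar)) : placedWord k (L ++ L') = placedWord k L' := by
  induction L with
  | nil => rfl
  | cons x L ih =>
    obtain ⟨e, t⟩ := x
    obtain rfl : t = .leaf := h (e, t) (by simp)
    exact ih fun x hx => h x (List.mem_cons_of_mem _ hx)

theorem length_placedEdges (k : ℕ) (L : List ((ℕ × ℕ) × Term ar)) :
    (placedEdges k L).length = (placedDc L).length := by
  induction k, L using placed_induction with
  | nil k => rfl
  | leaf k e L ih => exact ih
  | node k e s c L ih =>
    rw [placedEdges_node, placedDc_node k, List.length_cons, List.length_cons, ih]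

theorem map_fst_placedWord (k : ℕ) (L : List ((ℕ × ℕ) × Term ar)) :
    (placedWord k L).map Prod.fst = placedDc L :=
  List.map_fst_zip (length_placedEdges k L).ge

theorem map_snd_placedWord (k : ℕ) (L : List ((ℕ × ℕ) × Term ar)) :
    (placedWord k L).map Prod.snd = placedEdges k L :=
  List.map_snd_zip (length_placedEdges k L).le

theorem placedDc_cons (e : ℕ × ℕ) (t : Term ar) (L : List ((ℕ × ℕ) × Term ar)) :
    placedDc ((e, t) :: L) = t.dc ++ placedDc L := rfl

theorem length_edgesFrom (t : Term ar) (k : ℕ) (e : ℕ × ℕ) :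
    (t.edgesFrom k e).length = t.deg := by
  have := length_placedEdges k [(e, t)]
  simpa [placedEdges, placedDc, deg] using this

theorem placedWord_cons (k : ℕ) (e : ℕ × ℕ) (t : Term ar) (L : List ((ℕ × ℕ) × Term ar)) :
    placedWord k ((e, t) :: L) = placedWord k [(e, t)] ++ placedWord (k + t.deg) L := by
  rw [placedWord, placedWord, placedWord, placedDc_cons, placedEdges,
    List.zip_append (length_edgesFrom t k e).symm]
  simp [placedDc, placedEdges]

theorem length_placedWord (k : ℕ) (L : List ((ℕ × ℕ) × Term ar)) :
    (placedWord k L).length = (placedDc L).length := by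
  rw [← map_fst_placedWord k, List.length_map]

theorem placedWord_append (k : ℕ) (L L' : List ((ℕ × ℕ) × Term ar)) :
    placedWord k (L ++ L') = placedWord k L ++ placedWord (k + (placedWord k L).length) L' := by
  induction L generalizing k with
  | nil => rfl
  | cons x L ih =>
    obtain ⟨e, t⟩ := x
    rw [List.cons_append, placedWord_cons, ih, ← List.append_assoc, ← placedWord_cons,
      length_placedWord, length_placedWord, placedDc_cons, List.length_append, ← add_assoc]
    rfl

theorem edgesFrom_add (t : Term ar) (k m p l : ℕ) :
    t.edgesFrom (k + m) (p + m, l) = (t.edgesFrom k (p, l)).map fun e => (e.1 + m, e.2) := by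
  induction t generalizing k p l with
  | leaf => rfl
  | node s c ih =>
    simp only [edgesFrom, List.map_cons, List.map_flatten, List.map_ofFn]
    congr 2
    refine List.ofFn_inj.2 (funext fun j => ?_)
    rw [Function.comp_apply, ← ih]
    congr 1
    omega

theorem placedWord_singleton_add (t : Term ar) (k m p l : ℕ) :
    placedWord (k + m) [((p + m, l), t)]
      = (placedWord k [((p, l), t)]).map fun x => (x.1, x.2.1 + m, x.2.2) := by
  simp only [placedWord, placedEdges, edgesFrom_add, List.append_nil, List.zip_map_right, placedDc]
  rfl

theorem le_of_mem_edgesFrom (t : Term ar) (k : ℕ) (e : ℕ × ℕ) :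
    ∀ x ∈ t.edgesFrom k e, x = e ∨ k ≤ x.1 := by
  induction t generalizing k e with
  | leaf => intro x hx; simp [edgesFrom] at hx
  | node s c ih =>
    intro x hx
    rw [edgesFrom, List.mem_cons] at hx
    refine hx.imp_right fun hx => ?_
    obtain ⟨l, hl, hx⟩ := List.mem_flatten.1 hx
    obtain ⟨j, rfl⟩ := (List.mem_ofFn' _ _).1 hl
    rcases ih j _ _ x hx with rfl | h
    · exact le_rfl
    · omega

/-- The word of a node is its first letter followed by a word which does not depend on the slot of
the node. -/
theorem exists_placedWord_node (s : S) (c : Fin (ar s) → Term ar) (k : ℕ) (hk : 2 ≤ k) :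
    ∃ w : List (S × ℕ × ℕ), (∀ x ∈ w, 1 < x.2.1) ∧
      (∀ e, placedWord k [(e, .node s c)] = (s, e) :: w) ∧
      ∀ m e, placedWord (k + m) [(e, .node s c)]
        = (s, e) :: w.map fun x => (x.1, x.2.1 + m, x.2.2) := by
  refine ⟨placedWord (k + 1) (kids k c), ?_, fun e => ?_, fun m e => ?_⟩
  · intro x hx
    have h1 : x.2 ∈ placedEdges (k + 1) (kids k c ++ []) := by
      rw [List.append_nil, ← map_snd_placedWord]
      exact List.mem_map_of_mem hx
    rw [kids, placedEdges_ofFn_append, placedEdges, List.append_nil] at h1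
    obtain ⟨l, hl, hx⟩ := List.mem_flatten.1 h1
    obtain ⟨j, rfl⟩ := (List.mem_ofFn' _ _).1 hl
    rcases le_of_mem_edgesFrom _ _ _ _ hx with h | h
    · rw [h]
      exact hk
    · omega
  · rw [placedWord_node, List.append_nil]
  · have := placedWord_singleton_add (.node s c) k m 1 0
    rw [placedWord_node, placedWord_node, List.append_nil, List.append_nil, List.map_cons] at this
    rw [placedWord_node, List.append_nil, (List.cons.inj this).2]

/-! #### Words of placed terms are valid -/

theorem stack_cons {k : ℕ} {σ l : List (ℕ × ℕ)} {e : ℕ × ℕ} {m : ℕ} (hσ : IsStack k σ)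
    (h : e :: l = σ ++ List.replicate m (1, 0)) :
    (σ = [] ∧ e = (1, 0) ∧ l = List.replicate (m - 1) (1, 0)) ∨
      ∃ σ', σ = e :: σ' ∧ IsStack k σ' ∧ l = σ' ++ List.replicate m (1, 0) := by
  cases σ with
  | nil =>
    cases m with
    | zero => simp at h
    | succ m =>
      rw [List.nil_append, List.replicate_succ] at h
      exact Or.inl ⟨rfl, List.cons.inj h⟩
  | cons x σ =>
    obtain ⟨rfl, h2⟩ := List.cons.inj h
    exact Or.inr ⟨σ, rfl, hσ.tail, h2⟩

theorem push_bot {k : ℕ} {σ : List (ℕ × ℕ)} (hσ : IsStack k σ) (n a : ℕ) :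
    push n a (1, 0) σ = newSlots n a := by
  rw [push, List.filter_eq_nil_iff.2, List.append_nil]
  intro x hx
  have := hσ.2 x hx
  rw [decide_eq_true_eq]
  unfold SlotLT
  omega

theorem filter_split {k : ℕ} {σ₁ σ₂ : List (ℕ × ℕ)} {e : ℕ × ℕ} (hσ : IsStack k (σ₁ ++ e :: σ₂)) :
    ((σ₁ ++ e :: σ₂).filter fun x => SlotLT x e) = σ₂ := by
  obtain ⟨-, h2, h3⟩ := List.pairwise_append.1 hσ.1
  rw [List.filter_append, List.filter_eq_nil_iff.2, List.nil_append, List.filter_cons_of_neg,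
    List.filter_eq_self.2]
  · intro x hx
    rw [decide_eq_true_eq]
    exact (List.pairwise_cons.1 h2).1 x hx
  · rw [decide_eq_true_eq]
    unfold SlotLT
    omega
  · intro x hx
    have := h3 x hx e (by simp)
    rw [decide_eq_true_eq]
    unfold SlotLT at this ⊢
    omega

/-- On slots, `push` does what opening a node does to a list of placed terms. -/
theorem stack_push {k n a : ℕ} {σ l : List (ℕ × ℕ)} {e : ℕ × ℕ} {m : ℕ} (hσ : IsStack k σ)
    (h : e :: l = σ ++ List.replicate m (1, 0)) :
    ∃ m', newSlots n a ++ l = push n a e σ ++ List.replicate m' (1, 0) := by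
  rcases stack_cons hσ h with ⟨rfl, rfl, rfl⟩ | ⟨σ', rfl, -, rfl⟩
  · exact ⟨m - 1, by rw [push_bot hσ]⟩
  · exact ⟨m, by
      rw [push, ← List.nil_append (e :: σ'), filter_split hσ, List.append_assoc]⟩

/-- A top slot that is passed over is closed by the next insertion, so a leaf placed there leaves no
trace. -/
theorem push_cons {k n a : ℕ} {σ : List (ℕ × ℕ)} {e e' : ℕ × ℕ} (hσ : IsStack k (e :: σ))
    (he : e' = (1, 0) ∨ e' ∈ σ) : push n a e' (e :: σ) = push n a e' σ := by
  rw [push, push, List.filter_cons_of_neg]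
  rw [decide_eq_true_eq]
  rcases he with rfl | he
  · have := hσ.2 e (by simp)
    unfold SlotLT
    omega
  · have := (List.pairwise_cons.1 hσ.1).1 e' he
    unfold SlotLT at this ⊢
    omega

theorem isValid_cons {k n : ℕ} {σ : List (ℕ × ℕ)} {e : ℕ × ℕ} (hσ : IsStack k (e :: σ))
    {w : List (S × ℕ × ℕ)} (h : IsValid ar n σ w) : IsValid ar n (e :: σ) w := by
  cases w with
  | nil => trivial
  | cons x w =>
    obtain ⟨s, e'⟩ := x
    refine ⟨h.1.imp_right (List.mem_cons_of_mem _), ?_⟩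
    rw [push_cons hσ h.1]
    exact h.2

/-- If `w` is empty the slot `e` stays free: this is the case of an extreme leaf. -/
theorem finalStack_cons {k n : ℕ} {σ : List (ℕ × ℕ)} {e : ℕ × ℕ} (hσ : IsStack k (e :: σ))
    {w : List (S × ℕ × ℕ)} (hw : w ≠ []) (h : IsValid ar n σ w) :
    finalStack ar n (e :: σ) w = finalStack ar n σ w := by
  cases w with
  | nil => exact absurd rfl hw
  | cons x w =>
    obtain ⟨s, e'⟩ := x
    rw [finalStack, finalStack, push_cons hσ h.1]

theorem isValid_placedWord (k : ℕ) (L : List ((ℕ × ℕ) × Term ar)) (hk : 2 ≤ k)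
    {σ : List (ℕ × ℕ)} (hσ : IsStack k σ) {m : ℕ}
    (hL : L.map Prod.fst = σ ++ List.replicate m (1, 0)) :
    IsValid ar k σ (placedWord k L) := by
  induction k, L using placed_induction generalizing σ m with
  | nil k => trivial
  | leaf k e L ih =>
    rw [placedWord_leaf]
    rcases stack_cons hσ hL with ⟨rfl, rfl, h⟩ | ⟨σ', rfl, hσ', h⟩
    · exact ih hk hσ h
    · exact isValid_cons hσ (ih hk hσ' h)
  | node k e s c L ih =>
    rw [placedWord_node]
    refine ⟨?_, ?_⟩
    · rcases stack_cons hσ hL with ⟨rfl, rfl, h⟩ | ⟨σ', rfl, hσ', h⟩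
      · exact Or.inl rfl
      · exact Or.inr (by simp)
    · obtain ⟨m', hm⟩ := stack_push (n := k) (a := ar s) hσ hL
      refine ih (by omega) (isStack_push hk _ _ hσ) (m := m') ?_
      rw [List.map_append, map_fst_kids, hm]

/-! #### Correspondence with valid words -/

theorem map_map_bot (ts : List (Term ar)) :
    (ts.map fun t => (((1, 0) : ℕ × ℕ), t)).map Prod.fst = List.replicate ts.length (1, 0) := by
  rw [List.map_map]
  exact List.map_const' ..

theorem forall_mem_leaf (σ : List (ℕ × ℕ)) :
    ∀ x ∈ σ.map fun e => (e, (.leaf : Term ar)), x.2 = .leaf := by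
  intro x hx
  obtain ⟨e, -, rfl⟩ := List.mem_map.1 hx
  rfl

/-- Decoding goes from the end of the word: the tail is decoded over the pushed stack, and its first
terms become the children of the node read first. -/
theorem exists_placedWord_eq {w : List (S × ℕ × ℕ)} {k : ℕ} (hk : 2 ≤ k) {σ : List (ℕ × ℕ)}
    (hσ : IsStack k σ) (hw : IsValid ar k σ w) :
    ∃ (M : List ((ℕ × ℕ) × Term ar)) (ts : List (Term ar)), M.map Prod.fst = σ ∧
      (∀ t ∈ ts, t ≠ .leaf) ∧ placedWord k (M ++ ts.map fun t => ((1, 0), t)) = w := by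
  have hleaf : ∀ (σ : List (ℕ × ℕ)) (L : List ((ℕ × ℕ) × Term ar)),
      placedWord k (σ.map (fun e => (e, Term.leaf)) ++ L) = placedWord k L := fun σ L =>
    placedWord_of_leaves k (forall_mem_leaf σ) L
  have hfst : ∀ σ : List (ℕ × ℕ), (σ.map fun e => (e, (.leaf : Term ar))).map Prod.fst = σ := by
    intro σ
    rw [List.map_map]
    exact List.map_id _
  induction w generalizing k σ with
  | nil =>
    exact ⟨σ.map fun e => (e, .leaf), [], hfst σ, by simp, by rw [hleaf]; rfl⟩
  | cons x w ih =>
    obtain ⟨s, e⟩ := x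
    obtain ⟨M, ts, hM, hts, hw'⟩ := ih (by omega) (isStack_push hk _ _ hσ) hw.2
      (fun σ L => placedWord_of_leaves _ (forall_mem_leaf σ) L)
    obtain ⟨M₁, M₂, rfl, h1, h2⟩ := List.map_eq_append_iff.1 hM
    obtain ⟨c, rfl⟩ : ∃ c : Fin (ar s) → Term ar, M₁ = kids k c := by
      have hlen : M₁.length = ar s := by
        rw [← List.length_map (f := Prod.fst), h1, newSlots, List.length_ofFn]
      refine ⟨fun j => (M₁[(j : ℕ)]'(by omega)).2, List.ext_getElem (by simp [kids, hlen]) ?_⟩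
      intro i hi hi'
      simp only [kids, List.getElem_ofFn]
      refine Prod.ext ?_ rfl
      have h3 : (M₁.map Prod.fst)[i]'(by simpa using hi) = M₁[i].1 := List.getElem_map ..
      rw [← h3]
      simp only [h1, newSlots, List.getElem_ofFn]
    rw [List.append_assoc] at hw'
    -- A node at the root closes the whole stack, which is filled with leaves; otherwise leaves fill
    -- the slots above `e`, and those below keep the terms of `M₂`.
    by_cases he : e = (1, 0)
    · subst he
      have h3 := push_bot hσ k (ar s)
      rw [push, List.append_right_eq_self] at h3
      rw [h3] at h2
      obtain rfl := List.map_eq_nil_iff.1 h2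
      refine ⟨σ.map fun e => (e, .leaf), .node s c :: ts, hfst σ, ?_, ?_⟩
      · intro t ht
        rcases List.mem_cons.1 ht with rfl | ht
        · simp
        · exact hts t ht
      · rw [hleaf, List.map_cons, placedWord_node]
        rw [List.nil_append] at hw'
        rw [hw']
    · obtain ⟨σ₁, σ₂, rfl⟩ := List.append_of_mem (hw.1.resolve_left he)
      rw [filter_split hσ] at h2
      refine ⟨σ₁.map (fun e => (e, .leaf)) ++ (e, .node s c) :: M₂, ts, ?_, hts, ?_⟩
      · rw [List.map_append, hfst, List.map_cons, h2]
      · rw [List.append_assoc, hleaf, List.cons_append, placedWord_node, hw']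

/-- The first letter tells whether the term at the first slot of the stack is a leaf: the slot
occurs in it exactly when the term is a node. -/
theorem placedWord_injective (k : ℕ) (L : List ((ℕ × ℕ) × Term ar)) (hk : 2 ≤ k)
    {M M' : List ((ℕ × ℕ) × Term ar)} {ts ts' : List (Term ar)}
    (hL : L = M ++ ts.map fun t => ((1, 0), t)) (hts : ∀ t ∈ ts, t ≠ .leaf)
    (hts' : ∀ t ∈ ts', t ≠ .leaf) (hM : IsStack k (M.map Prod.fst))
    (hMM' : M.map Prod.fst = M'.map Prod.fst)
    (h : placedWord k L = placedWord k (M' ++ ts'.map fun t => ((1, 0), t))) :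
    M = M' ∧ ts = ts' := by
  -- By validity, terms placed strictly below `e` give a word whose first letter cannot sit at `e`.
  have key : ∀ (k : ℕ) (e : ℕ × ℕ) (M N : List ((ℕ × ℕ) × Term ar)) (ts : List (Term ar)) (s : S)
      (w : List (S × ℕ × ℕ)), 2 ≤ k → M.map Prod.fst = N.map Prod.fst →
      IsStack k (e :: M.map Prod.fst) →
      placedWord k (N ++ ts.map fun t => ((1, 0), t)) ≠ (s, e) :: w := by
    intro k e M N ts s w hk hMN hσ h
    have h1 : IsValid ar k (N.map Prod.fst) (placedWord k (N ++ ts.map fun t => ((1, 0), t))) :=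
      isValid_placedWord k _ hk (hMN ▸ hσ.tail) (by rw [List.map_append, map_map_bot])
    rw [h, ← hMN] at h1
    rcases h1.1 with rfl | h1
    · have := hσ.2 (1, 0) (by simp)
      omega
    · have := (List.pairwise_cons.1 hσ.1).1 e h1
      unfold SlotLT at this
      omega
  induction k, L using placed_induction generalizing M M' ts ts' with
  | nil k =>
    obtain ⟨rfl, h2⟩ := List.append_eq_nil_iff.1 hL.symm
    obtain rfl := List.map_eq_nil_iff.1 h2
    obtain rfl := List.map_eq_nil_iff.1 hMM'.symm
    match ts' with
    | [] => exact ⟨rfl, rfl⟩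
    | .leaf :: _ => exact absurd rfl (hts' .leaf (by simp))
    | .node s c :: ts' =>
      rw [List.nil_append, List.map_cons, placedWord_node] at h
      simp [placedWord_nil] at h
  | leaf k e L ih =>
    match M, M' with
    | [], _ =>
      match ts with
      | [] => simp at hL
      | t :: ts =>
        rw [List.nil_append, List.map_cons] at hL
        have := (Prod.ext_iff.1 (List.cons.inj hL).1).2
        exact absurd this.symm (hts t (by simp))
    | _ :: _, [] => simp at hMM'
    | (e', t) :: M, (e'', t') :: M' =>
      rw [List.cons_append] at hL
      obtain ⟨h1, h2⟩ := List.cons.inj hL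
      obtain ⟨rfl, rfl⟩ := Prod.mk.inj h1
      obtain ⟨h3, h4⟩ := List.cons.inj hMM'
      subst h3
      cases t' with
      | leaf =>
        obtain ⟨h5, h6⟩ := ih hk h2 hts hts' hM.tail h4 h
        exact ⟨by rw [h5], h6⟩
      | node s c =>
        rw [placedWord_leaf, List.cons_append, placedWord_node, h2] at h
        exact absurd h (key k _ M M ts s _ hk rfl hM)
  | node k e s c L ih =>
    match M, M' with
    | [], _ :: _ => simp at hMM'
    | _ :: _, [] => simp at hMM'
    | [], [] =>
      match ts, ts' with
      | [], _ => simp at hL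
      | _, .leaf :: _ => exact absurd rfl (hts' .leaf (by simp))
      | t :: ts, [] =>
        rw [placedWord_node] at h
        simp [placedWord_nil] at h
      | t :: ts, .node s' c' :: ts' =>
        rw [List.nil_append, List.map_cons] at hL
        obtain ⟨h1, h2⟩ := List.cons.inj hL
        obtain ⟨rfl, rfl⟩ := Prod.mk.inj h1
        rw [List.nil_append, List.map_cons, placedWord_node, placedWord_node] at h
        obtain ⟨h3, h4⟩ := List.cons.inj h
        obtain rfl := (Prod.ext_iff.1 h3).1
        obtain ⟨h5, h6⟩ := ih (by omega) (by rw [h2])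
          (fun t ht => hts t (List.mem_cons_of_mem _ ht))
          (fun t ht => hts' t (List.mem_cons_of_mem _ ht))
          (by rw [map_fst_kids, ← push_bot (isStack_nil k)]
              exact isStack_push hk _ _ (isStack_nil k))
          (by rw [map_fst_kids, map_fst_kids]) h4
        rw [kids_injective k h5, h6]
        exact ⟨rfl, rfl⟩
    | (e', t) :: M, (e'', t') :: M' =>
      rw [List.cons_append] at hL
      obtain ⟨h1, h2⟩ := List.cons.inj hL
      obtain ⟨rfl, rfl⟩ := Prod.mk.inj h1
      obtain ⟨h3, h4⟩ := List.cons.inj hMM'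
      subst h3
      cases t' with
      | leaf =>
        rw [placedWord_node, List.cons_append, placedWord_leaf] at h
        exact absurd h.symm (key k _ M M' ts' s _ hk h4 hM)
      | node s' c' =>
        rw [List.cons_append, placedWord_node, placedWord_node] at h
        obtain ⟨h3, h5⟩ := List.cons.inj h
        obtain rfl := (Prod.ext_iff.1 h3).1
        rw [← List.append_assoc] at h5
        have hst := isStack_push hk (ar s) e hM
        rw [List.map_cons, push, ← List.nil_append (e :: _), filter_split hM] at hst
        obtain ⟨h6, h7⟩ := ih (by omega) (by rw [h2, List.append_assoc]) hts hts'
          (by rw [List.map_append, map_fst_kids]; exact hst)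
          (by rw [List.map_append, List.map_append, map_fst_kids, map_fst_kids, h4]) h5
        obtain ⟨h8, h9⟩ := List.append_inj h6 (by simp [kids])
        rw [kids_injective k h8, h9, h7]
        exact ⟨rfl, rfl⟩

end Placed

/-! ### Substitution for the leaves of placed terms -/

section Substitution

variable {S : Type u} {ar : S → ℕ}

open Term

/-- Substitution for the leaves of placed terms, numbered `q, q + 1, …`. -/
def placedSubst (ς : ℕ → Term ar) :
    ℕ → List ((ℕ × ℕ) × Term ar) → List ((ℕ × ℕ) × Term ar)
  | _, [] => []
  | q, (e, t) :: L => (e, t.leafSubst ς q) :: placedSubst ς (q + t.numLeaves) L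

/-- The number of leaves of placed terms. -/
def placedLeaves (L : List ((ℕ × ℕ) × Term ar)) : ℕ := (L.map fun x => x.2.numLeaves).sum

/-- The number of extreme leaves of placed terms. -/
def placedExtreme (L : List ((ℕ × ℕ) × Term ar)) : ℕ :=
  ((L.flatMap fun x => x.2.preorder).reverse.takeWhile Option.isNone).length

theorem placedSubst_ofFn_append (ς : ℕ → Term ar) {n : ℕ} (g : Fin n → ℕ × ℕ)
    (c : Fin n → Term ar) (L : List ((ℕ × ℕ) × Term ar)) (q : ℕ) :
    placedSubst ς q ((List.ofFn fun j => (g j, c j)) ++ L)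
      = (List.ofFn fun j =>
          (g j, (c j).leafSubst ς (q + ∑ i ∈ Finset.Iio j, (c i).numLeaves)))
        ++ placedSubst ς (q + ∑ j, (c j).numLeaves) L := by
  induction n generalizing q with
  | zero => simp
  | succ n ih =>
    rw [List.ofFn_succ, List.cons_append, placedSubst, ih, List.ofFn_succ, List.cons_append,
      Fin.sum_univ_succ]
    simp only [sum_Iio_succ, ← add_assoc]
    have : Finset.Iio (0 : Fin (n + 1)) = ∅ := by ext; simp
    rw [this, Finset.sum_empty, add_zero]

theorem placedSubst_node (ς : ℕ → Term ar) (q k : ℕ) (e : ℕ × ℕ) (s : S)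
    (c : Fin (ar s) → Term ar) (L : List ((ℕ × ℕ) × Term ar)) :
    ∃ (c' : Fin (ar s) → Term ar) (L' : List ((ℕ × ℕ) × Term ar)),
      placedSubst ς q ((e, .node s c) :: L) = (e, .node s c') :: L' ∧
      placedSubst ς q (kids k c ++ L) = kids k c' ++ L' := by
  refine ⟨_, _, rfl, ?_⟩
  rw [kids, placedSubst_ofFn_append, numLeaves_node]
  rfl

theorem placedLeaves_node (k : ℕ) (e : ℕ × ℕ) (s : S) (c : Fin (ar s) → Term ar)
    (L : List ((ℕ × ℕ) × Term ar)) :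
    placedLeaves ((e, .node s c) :: L) = placedLeaves (kids k c ++ L) := by
  rw [placedLeaves, placedLeaves, List.map_cons, List.sum_cons, List.map_append, List.sum_append,
    kids, List.map_ofFn, List.sum_ofFn, numLeaves_node]
  rfl

theorem placedExtreme_node (k : ℕ) (e : ℕ × ℕ) (s : S) (c : Fin (ar s) → Term ar)
    (L : List ((ℕ × ℕ) × Term ar)) :
    placedExtreme ((e, .node s c) :: L) = placedExtreme (kids k c ++ L) := by
  rw [placedExtreme, placedExtreme, List.flatMap_cons, preorder, List.cons_append,
    List.reverse_cons, Forest.takeWhile_append_some, List.flatMap_append,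
    List.flatMap_def (l := kids k c), kids, List.map_ofFn]
  rfl

theorem placedLeaves_leaf (e : ℕ × ℕ) (L : List ((ℕ × ℕ) × Term ar)) :
    placedLeaves ((e, .leaf) :: L) = placedLeaves L + 1 := by
  rw [placedLeaves, List.map_cons, List.sum_cons, add_comm]
  rfl

theorem placedExtreme_le (L : List ((ℕ × ℕ) × Term ar)) : placedExtreme L ≤ placedLeaves L := by
  have h : ∀ l : List (Option S),
      (l.takeWhile Option.isNone).length ≤ l.countP Option.isNone := fun l =>
    (List.takeWhile_prefix _).sublist.countP_le.trans' (by
      rw [List.countP_eq_length.2]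
      exact fun a ha => List.mem_takeWhile_imp ha)
  refine (h _).trans_eq ?_
  rw [List.countP_reverse, List.countP_flatMap]
  rfl

theorem placedExtreme_of_leaves {L : List ((ℕ × ℕ) × Term ar)} (h : ∀ x ∈ L, x.2 = .leaf) :
    placedExtreme L = L.length ∧ placedLeaves L = L.length := by
  have h1 : (L.flatMap fun x => x.2.preorder) = List.replicate L.length none := by
    induction L with
    | nil => rfl
    | cons x L ih =>
      rw [List.flatMap_cons, ih fun x hx => h x (List.mem_cons_of_mem _ hx), h x (by simp)]
      rfl
  refine ⟨?_, ?_⟩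
  · rw [placedExtreme, h1, List.reverse_replicate, List.takeWhile_replicate]
    simp
  · rw [placedLeaves, List.map_congr_left (g := fun _ => 1) fun x hx => by rw [h x hx]; rfl]
    simp

/-- An internal node is visited after the leading leaf. -/
theorem placedExtreme_leaf {L : List ((ℕ × ℕ) × Term ar)} (h : ¬ ∀ x ∈ L, x.2 = .leaf)
    (e : ℕ × ℕ) : placedExtreme ((e, .leaf) :: L) = placedExtreme L := by
  have hnode : ∃ o ∈ (L.flatMap fun x => x.2.preorder).reverse, ¬ Option.isNone o = true := by
    push Not at h
    obtain ⟨x, hx, hne⟩ := h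
    obtain ⟨e, t⟩ := x
    cases t with
    | leaf => exact absurd rfl hne
    | node s c =>
      exact ⟨some s, List.mem_reverse.2 (List.mem_flatMap.2 ⟨_, hx, by simp [preorder]⟩), by simp⟩
  rw [placedExtreme, placedExtreme, List.flatMap_cons, List.reverse_append]
  generalize (L.flatMap fun x => x.2.preorder).reverse = l at hnode
  congr 1
  induction l with
  | nil => simp at hnode
  | cons o l ih =>
    cases o with
    | none =>
      rw [List.cons_append, List.takeWhile_cons_of_pos rfl, List.takeWhile_cons_of_pos rfl, ih]
      simpa using hnode
    | some s => simp

theorem placedWord_ne_nil {L : List ((ℕ × ℕ) × Term ar)} (h : ¬ ∀ x ∈ L, x.2 = .leaf) (k : ℕ) :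
    placedWord k L ≠ [] := by
  induction L with
  | nil => simp at h
  | cons x L ih =>
    obtain ⟨e, t⟩ := x
    cases t with
    | leaf =>
      rw [placedWord_leaf]
      refine ih fun h' => h fun x hx => ?_
      rcases List.mem_cons.1 hx with rfl | hx
      · rfl
      · exact h' x hx
    | node s c => simp [placedWord_node]

theorem placedSubst_of_leaves (ς : ℕ → Term ar) {L : List ((ℕ × ℕ) × Term ar)}
    (h : ∀ x ∈ L, x.2 = .leaf) (q : ℕ) {Y : List (Term ar)} (hY : Y.length = L.length)
    (hς : ∀ i (hi : i < Y.length), ς (q + i) = Y[i]) :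
    placedSubst ς q L = (L.map Prod.fst).zip Y := by
  induction L generalizing q Y with
  | nil => rfl
  | cons x L ih =>
    obtain ⟨e, t⟩ := x
    obtain rfl : t = .leaf := h (e, t) (by simp)
    cases Y with
    | nil => simp at hY
    | cons y Y =>
      have h0 := hς 0 (by simp)
      rw [placedSubst, ih (fun x hx => h x (List.mem_cons_of_mem _ hx)) (Y := Y) _
        (by simpa using hY)]
      · rw [List.map_cons, List.zip_cons_cons, leafSubst]
        rw [show ς q = y from h0]
      · intro i hi
        have := hς (i + 1) (by simpa using hi)
        rw [show q + (leaf : Term ar).numLeaves + i = q + (i + 1) by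
          change q + 1 + i = _
          omega]
        simpa using this

theorem exists_extremeSlots_of_leaves (k : ℕ) {L : List ((ℕ × ℕ) × Term ar)}
    (hall : ∀ x ∈ L, x.2 = .leaf) {σ : List (ℕ × ℕ)} {m : ℕ}
    (hL : L.map Prod.fst = σ ++ List.replicate m (1, 0)) :
    ∃ m', (finalStack ar k σ (placedWord k L)).length + m' = placedExtreme L ∧
      ∀ (ς : ℕ → Term ar) (q : ℕ) (Y : List (Term ar)), Y.length = placedExtreme L →
        (∀ i < placedLeaves L - placedExtreme L, ς (q + i) = .leaf) →
        (∀ i (hi : i < Y.length), ς (q + (placedLeaves L - placedExtreme L) + i) = Y[i]) →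
        placedWord k (placedSubst ς q L) = placedWord k L ++
          placedWord (k + (placedWord k L).length)
            ((finalStack ar k σ (placedWord k L) ++ List.replicate m' (1, 0)).zip Y) := by
  · have hw : placedWord k L = [] := by
      have := placedWord_of_leaves k hall []
      rwa [List.append_nil] at this
    obtain ⟨h1, h2⟩ := placedExtreme_of_leaves hall
    rw [hw, h1, h2]
    refine ⟨m, ?_, fun ς q Y hY _ hς => ?_⟩
    · rw [← List.length_map (as := L) (f := Prod.fst), hL, List.length_append,
      List.length_replicate]
      rfl
    · rw [placedSubst_of_leaves ς hall q hY (by simpa using hς), hL]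
      rfl

/-- The slots of the extreme leaves of placed terms: they are the free slots at the end of the word,
and substituting terms for the extreme leaves amounts to placing these terms at these slots. -/
theorem exists_extremeSlots (k : ℕ) (L : List ((ℕ × ℕ) × Term ar)) (hk : 2 ≤ k)
    {σ : List (ℕ × ℕ)} (hσ : IsStack k σ) {m : ℕ}
    (hL : L.map Prod.fst = σ ++ List.replicate m (1, 0)) :
    ∃ m', (finalStack ar k σ (placedWord k L)).length + m' = placedExtreme L ∧
      ∀ (ς : ℕ → Term ar) (q : ℕ) (Y : List (Term ar)), Y.length = placedExtreme L →
        (∀ i < placedLeaves L - placedExtreme L, ς (q + i) = .leaf) →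
        (∀ i (hi : i < Y.length), ς (q + (placedLeaves L - placedExtreme L) + i) = Y[i]) →
        placedWord k (placedSubst ς q L) = placedWord k L ++
          placedWord (k + (placedWord k L).length)
            ((finalStack ar k σ (placedWord k L) ++ List.replicate m' (1, 0)).zip Y) := by
  induction k, L using placed_induction generalizing σ m with
  | nil k => exact exists_extremeSlots_of_leaves k (by simp) hL
  | leaf k e L ih =>
    -- The leading leaf is extreme only if no internal node follows. Otherwise the next insertion
    -- closes its slot, and the leaves of `L` are numbered one further.
    by_cases hall : ∀ x ∈ L, x.2 = .leaf
    · exact exists_extremeSlots_of_leaves k (List.forall_mem_cons.2 ⟨rfl, hall⟩) hL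
    have hle := placedExtreme_le L
    have hstep : ∃ (σ' : List (ℕ × ℕ)) (n : ℕ), IsStack k σ' ∧
        L.map Prod.fst = σ' ++ List.replicate n (1, 0) ∧
        finalStack ar k σ (placedWord k L) = finalStack ar k σ' (placedWord k L) := by
      rcases stack_cons hσ hL with ⟨rfl, rfl, h⟩ | ⟨σ', rfl, hσ', h⟩
      · exact ⟨[], m - 1, hσ, h, rfl⟩
      · exact ⟨σ', m, hσ', h,
          finalStack_cons hσ (placedWord_ne_nil hall k) (isValid_placedWord k L hk hσ' h)⟩
    obtain ⟨σ', n, hσ', hL', hfin⟩ := hstep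
    obtain ⟨m', h1, h2⟩ := ih hk hσ' hL'
    rw [placedWord_leaf, placedExtreme_leaf hall, placedLeaves_leaf, hfin]
    refine ⟨m', h1, fun ς q Y hY hς hς' => ?_⟩
    rw [placedSubst, leafSubst, show ς q = .leaf from hς 0 (by omega), placedWord_leaf]
    refine h2 ς _ Y hY (fun i hi => ?_) (fun i hi => ?_)
    · have := hς (i + 1) (by omega)
      rwa [add_comm i, ← add_assoc] at this
    · rw [← hς' i hi]
      congr 1
      change q + 1 + _ + _ = _
      omega
  | node k e s c L ih =>
    obtain ⟨n, hn⟩ := stack_push (n := k) (a := ar s) hσ hL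
    rw [← map_fst_kids k c, ← List.map_append] at hn
    have hσ' := isStack_push hk (ar s) e hσ
    obtain ⟨m', h1, h2⟩ := ih (by omega) hσ' hn
    rw [placedWord_node, placedExtreme_node k, placedLeaves_node k, finalStack]
    refine ⟨m', h1, fun ς q Y hY hς hς' => ?_⟩
    obtain ⟨c', L', h3, h4⟩ := placedSubst_node ς q k e s c L
    rw [h3, placedWord_node, ← h4, h2 ς q Y hY hς hς', List.cons_append, List.length_cons,
      add_right_comm k 1, add_assoc k]

end Substitution

/-! ### Words of forests -/

section ForestWords

variable {S : Type u} {ar : S → ℕ}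

open Term

/-- The word of the nodes of a forest given by the list of its terms, without its root. -/
def forestWord (ts : List (Term ar)) : List (S × ℕ × ℕ) :=
  placedWord 2 (ts.map fun t => ((1, 0), t))

/-- The terms different from the leaf precede the leaves. -/
def IsTilted (ts : List (Term ar)) : Prop := ts.Pairwise fun t t' => t = .leaf → t' = .leaf

theorem _root_.EasterlyWind.Forest.IsRootTilted.isTilted {f : Forest ar} (h : f.IsRootTilted) :
    IsTilted (List.ofFn f.trees) :=
  List.pairwise_ofFn.2 fun i j hij => h i j hij

theorem isValid_forestWord (ts : List (Term ar)) : IsValid ar 2 [] (forestWord ts) :=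
  isValid_placedWord 2 _ le_rfl (isStack_nil 2) (map_map_bot ts)

theorem isNormal_forestWord (ts : List (Term ar)) : IsNormal (forestWord ts) :=
  (isValid_forestWord ts).isNormal le_rfl (isStack_nil 2)

theorem placedDc_map (ts : List (Term ar)) :
    placedDc (ts.map fun t => (((1, 0) : ℕ × ℕ), t)) = ts.flatMap dc := by
  rw [placedDc, List.flatMap_map]

theorem map_fst_forestWord (ts : List (Term ar)) :
    (forestWord ts).map Prod.fst = ts.flatMap dc := by
  rw [forestWord, map_fst_placedWord, placedDc_map]

theorem length_forestWord (ts : List (Term ar)) :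
    (forestWord ts).length = (ts.map deg).sum := by
  rw [← List.length_map (f := Prod.fst), map_fst_forestWord, List.length_flatMap]
  rfl

theorem placedWord_eq_nil {k : ℕ} {L : List ((ℕ × ℕ) × Term ar)} (h : ∀ x ∈ L, x.2 = .leaf) :
    placedWord k L = [] := by
  have := placedWord_of_leaves k h []
  rwa [List.append_nil] at this

theorem forestWord_append_leaves (ts : List (Term ar)) (m : ℕ) :
    forestWord (ts ++ List.replicate m .leaf) = forestWord ts := by
  rw [forestWord, List.map_append, placedWord_append,
    placedWord_eq_nil (L := (List.replicate m _).map _), List.append_nil, forestWord]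
  intro x hx
  obtain ⟨t, ht, rfl⟩ := List.mem_map.1 hx
  exact List.eq_of_mem_replicate ht

/-- Tilting is essential: a leaf before a node would use up a slot of `τ` without giving a letter,
whereas `attach` counts only letters. -/
theorem placedWord_zip {ts : List (Term ar)} (hts : IsTilted ts) {k m r : ℕ} (hk : 2 ≤ k)
    {τ : List (ℕ × ℕ)} (hlen : ts.length ≤ τ.length + r) :
    placedWord (k + m) ((τ ++ List.replicate r (1, 0)).zip ts)
      = attach m τ (placedWord k (ts.map fun t => ((1, 0), t))) := by
  induction ts generalizing k τ r with
  | nil => rw [List.zip_nil_right]; rfl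
  | cons t ts ih =>
    obtain ⟨h1, h2⟩ := List.pairwise_cons.1 hts
    obtain ⟨r', hr, hr'⟩ : ∃ r', τ ++ List.replicate r ((1, 0) : ℕ × ℕ)
        = τ.headD (1, 0) :: (τ.tail ++ List.replicate r' (1, 0)) ∧
        ts.length ≤ τ.tail.length + r' := by
      rw [List.length_cons] at hlen
      cases τ with
      | nil =>
        cases r with
        | zero => simp at hlen
        | succ r => exact ⟨r, by simp [List.replicate_succ], by simpa using hlen⟩
      | cons x τ => exact ⟨r, by simp, by simp at hlen ⊢; omega⟩
    cases t with
    | leaf =>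
      have hall : ∀ t ∈ (.leaf :: ts : List (Term ar)), t = .leaf :=
        List.forall_mem_cons.2 ⟨rfl, fun t ht => h1 t ht rfl⟩
      rw [placedWord_eq_nil, placedWord_eq_nil, attach]
      · intro x hx
        obtain ⟨t, ht, rfl⟩ := List.mem_map.1 hx
        exact hall t ht
      · intro x hx
        exact hall _ (List.of_mem_zip (a := x.1) (b := x.2) hx).2
    | node s c =>
      obtain ⟨w, hw, hw1, hw2⟩ := exists_placedWord_node s c k hk
      rw [hr, List.zip_cons_cons, placedWord_cons, hw2, List.map_cons, placedWord_cons k, hw1,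
        add_right_comm k m, ih h2 (by omega) hr', List.cons_append, List.cons_append, attach,
        if_pos le_rfl, attach_eq_map_append hw]

theorem forestWord_append {ts ts' : List (Term ar)} (hts' : ∀ t ∈ ts', t ≠ .leaf) :
    forestWord (ts ++ ts')
      = forestWord ts ++ attach (forestWord ts).length [] (forestWord ts') := by
  have h : IsTilted ts' :=
    List.pairwise_iff_getElem.2 fun i _ hi _ _ h => absurd h (hts' _ (List.getElem_mem hi))
  have key := placedWord_zip h (m := (forestWord ts).length) (r := ts'.length) le_rfl (τ := [])
    (by simp)
  rw [← forestWord] at key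
  rw [← key, List.nil_append, forestWord, List.map_append, placedWord_append]
  congr 2
  refine List.ext_getElem (by simp) fun i hi hi' => ?_
  simp

/-! #### The under operation -/

theorem isNone_comp_map {α β : Type*} (g : α → β) :
    (fun o : Option α => (o.map g).isNone) = Option.isNone := by
  funext o
  cases o <;> rfl

theorem placedExtreme_map (f : Forest ar) :
    placedExtreme ((List.ofFn f.trees).map fun t => (((1, 0) : ℕ × ℕ), t))
      = f.toTerm.numExtreme := by
  have h : f.body = ((List.ofFn f.trees).flatMap preorder).map (Option.map Sum.inl) := by
    rw [Forest.body, List.map_flatMap, List.flatMap_def]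
    simp only [preorder_lift]
  rw [Forest.numExtreme_toTerm, h, ← List.map_reverse, List.takeWhile_map, List.length_map,
    placedExtreme, List.flatMap_map]
  congr 2
  exact (isNone_comp_map _).symm

theorem placedLeaves_map (f : Forest ar) :
    placedLeaves ((List.ofFn f.trees).map fun t => (((1, 0) : ℕ × ℕ), t))
      = f.toTerm.numLeaves := by
  rw [Forest.numLeaves_toTerm, placedLeaves, List.map_map, List.map_ofFn, List.sum_ofFn]
  rfl

theorem placedSubst_map (ς : ℕ → Term ar) (f : Forest ar) :
    placedSubst ς 0 ((List.ofFn f.trees).map fun t => (((1, 0) : ℕ × ℕ), t))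
      = (List.ofFn (f.leafSubst ς).trees).map fun t => ((1, 0), t) := by
  rw [List.map_ofFn, List.map_ofFn]
  have := placedSubst_ofFn_append ς (fun _ => (1, 0)) f.trees [] 0
  simp only [List.append_nil, placedSubst, zero_add] at this
  exact this

theorem ofFn_concat_corolla (f : Forest ar) (m : ℕ) :
    List.ofFn (f.concat (Forest.corolla m)).trees
      = List.ofFn f.trees ++ List.replicate m .leaf := by
  have : List.ofFn (f.concat (Forest.corolla m)).trees
      = List.ofFn (Fin.append f.trees fun _ : Fin m => .leaf) := rfl
  rw [this, List.ofFn_fin_append, List.ofFn_const]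

/-- The leaves appended to both forests do not change their words; they only make the number of
grafted terms equal to the number of extreme leaves. By `exists_extremeSlots`, grafting then means
placing the terms at the final free slots. -/
theorem forestWord_under (f₁ f₂ : Forest ar) (h₂ : f₂.IsRootTilted) :
    forestWord (List.ofFn (f₁.under f₂).trees) = forestWord (List.ofFn f₁.trees) ++
      attach (forestWord (List.ofFn f₁.trees)).length
        (finalStack ar 2 [] (forestWord (List.ofFn f₁.trees)))
        (forestWord (List.ofFn f₂.trees)) := by
  have hg : forestWord (List.ofFn (f₁.concat (Forest.corolla f₂.n)).trees)
      = forestWord (List.ofFn f₁.trees) := by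
    rw [ofFn_concat_corolla, forestWord_append_leaves]
  have hh : forestWord (List.ofFn (f₂.concat (Forest.corolla f₁.toTerm.numExtreme)).trees)
      = forestWord (List.ofFn f₂.trees) := by
    rw [ofFn_concat_corolla, forestWord_append_leaves]
  have hn : (f₂.concat (Forest.corolla f₁.toTerm.numExtreme)).n
      = (f₁.concat (Forest.corolla f₂.n)).toTerm.numExtreme := by
    rw [Forest.numExtreme_concat_corolla, add_comm]
    rfl
  have ht := (h₂.concat_corolla f₁.toTerm.numExtreme).isTilted
  rw [Forest.under, ← hg, ← hh]
  generalize f₁.concat (Forest.corolla f₂.n) = g at *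
  generalize f₂.concat (Forest.corolla f₁.toTerm.numExtreme) = h at *
  obtain ⟨m', h1, h2⟩ := exists_extremeSlots 2
    ((List.ofFn g.trees).map fun t => (((1, 0) : ℕ × ℕ), t)) le_rfl (isStack_nil 2)
    (map_map_bot _)
  rw [placedExtreme_map] at h1 h2
  rw [placedLeaves_map] at h2
  have hY : (List.ofFn h.trees).length = g.toTerm.numExtreme := by rw [List.length_ofFn, hn]
  rw [Forest.graftExtreme, forestWord, ← placedSubst_map, h2 _ 0 (List.ofFn h.trees) hY,
    placedWord_zip ht le_rfl, ← forestWord, ← forestWord]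
  · rw [hY, ← h1]
  · intro i hi
    rw [dif_neg (by omega)]
  · intro i hi
    rw [List.length_ofFn] at hi
    rw [dif_pos (by omega), List.getElem_ofFn]
    congr 1
    exact Fin.ext (by simp only; omega)

/-! #### The connection word -/

theorem edgesFrom_lift (t : Term ar) (k : ℕ) (e : ℕ × ℕ) :
    t.lift.edgesFrom k e = t.edgesFrom k e := by
  induction t generalizing k e with
  | leaf => rfl
  | node s c ih =>
    rw [lift, edgesFrom, edgesFrom]
    congr 2
    refine List.ofFn_inj.2 (funext fun j => (ih j _ _).trans ?_)
    simp only [deg_lift]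
    rfl

theorem dc_lift (t : Term ar) : t.lift.dc = t.dc.map Sum.inl := by
  induction t with
  | leaf => rfl
  | node s c ih =>
    simp only [lift, dc_node, List.map_cons, List.map_flatten, List.map_ofFn]
    congr 2
    exact List.ofFn_inj.2 (funext ih)

theorem dc_toTerm (f : Forest ar) : f.toTerm.dc
    = Sum.inr f.n :: ((forestWord (List.ofFn f.trees)).map Prod.fst).map Sum.inl := by
  rw [Forest.toTerm, dc_node, map_fst_forestWord, List.map_flatMap, List.flatMap_def, List.map_ofFn]
  simp only [dc_lift]
  rfl

/-- The terms of a list, placed at the positions `j + 1, j + 2, …` of the node `1`. -/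
def rootPlaced : ℕ → List (Term ar) → List ((ℕ × ℕ) × Term ar)
  | _, [] => []
  | j, t :: ts => ((1, j + 1), t) :: rootPlaced (j + 1) ts

theorem ofFn_eq_rootPlaced {n : ℕ} (c : Fin n → Term ar) (q : ℕ) :
    (List.ofFn fun j : Fin n => ((1, q + j + 1), c j)) = rootPlaced q (List.ofFn c) := by
  induction n generalizing q with
  | zero => simp [rootPlaced]
  | succ n ih =>
    rw [List.ofFn_succ, List.ofFn_succ, rootPlaced, ← ih]
    congr 2
    funext j
    rw [Fin.val_succ, add_assoc q 1, add_comm 1 (j : ℕ)]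

theorem parentEdges_toTerm (f : Forest ar) :
    f.toTerm.parentEdges = (1, 0) :: placedEdges 2 (rootPlaced 0 (List.ofFn f.trees)) := by
  have := placedEdges_ofFn_append (fun j : Fin f.n => (1, 0 + (j : ℕ) + 1)) f.trees [] 2
  rw [List.append_nil, placedEdges, List.append_nil, ofFn_eq_rootPlaced] at this
  rw [this, Forest.toTerm, parentEdges, edgesFrom]
  simp only [edgesFrom_lift, deg_lift, zero_add]
  rfl

/-- Replace the slots of the children of the root by their positions `j + 1, j + 2, …`. -/
def label : ℕ → List (ℕ × ℕ) → List (ℕ × ℕ)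
  | _, [] => []
  | j, e :: w => if e.1 ≤ 1 then (1, j + 1) :: label (j + 1) w else e :: label j w

theorem label_append {l : List (ℕ × ℕ)} (hl : ∀ e ∈ l, 1 < e.1) (j : ℕ) (l' : List (ℕ × ℕ)) :
    label j (l ++ l') = l ++ label j l' := by
  induction l with
  | nil => rfl
  | cons e l ih =>
    rw [List.cons_append, label, if_neg (by have := hl e (by simp); omega),
      ih fun e he => hl e (List.mem_cons_of_mem _ he)]
    rfl

theorem exists_edgesFrom_node (s : S) (c : Fin (ar s) → Term ar) (k : ℕ) (hk : 2 ≤ k) :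
    ∃ l : List (ℕ × ℕ), (∀ e ∈ l, 1 < e.1) ∧ ∀ e, (node s c).edgesFrom k e = e :: l := by
  refine ⟨_, ?_, fun e => by rw [edgesFrom]⟩
  intro x hx
  obtain ⟨l, hl, hx⟩ := List.mem_flatten.1 hx
  obtain ⟨j, rfl⟩ := (List.mem_ofFn' _ _).1 hl
  rcases le_of_mem_edgesFrom _ _ _ _ hx with h | h
  · rw [h]
    exact hk
  · omega

theorem placedEdges_eq_nil {k : ℕ} {L : List ((ℕ × ℕ) × Term ar)} (h : ∀ x ∈ L, x.2 = .leaf) :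
    placedEdges k L = [] := by
  rw [← map_snd_placedWord, placedWord_eq_nil h, List.map_nil]

theorem snd_eq_leaf_of_mem_rootPlaced {ts : List (Term ar)} (h : ∀ t ∈ ts, t = .leaf) (j : ℕ) :
    ∀ x ∈ rootPlaced j ts, x.2 = .leaf := by
  induction ts generalizing j with
  | nil => intro x hx; simp [rootPlaced] at hx
  | cons t ts ih =>
    obtain ⟨h1, h2⟩ := List.forall_mem_cons.1 h
    exact List.forall_mem_cons.2 ⟨h1, ih h2 _⟩

/-- By tilting, the root children that are nodes have consecutive positions, recovered by counting
the root letters. -/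
theorem placedEdges_rootPlaced {ts : List (Term ar)} (hts : IsTilted ts) {k : ℕ} (hk : 2 ≤ k)
    (j : ℕ) : placedEdges k (rootPlaced j ts)
      = label j (placedEdges k (ts.map fun t => ((1, 0), t))) := by
  induction ts generalizing k j with
  | nil => rfl
  | cons t ts ih =>
    obtain ⟨h1, h2⟩ := List.pairwise_cons.1 hts
    cases t with
    | leaf =>
      have hall : ∀ t ∈ (.leaf :: ts : List (Term ar)), t = .leaf :=
        List.forall_mem_cons.2 ⟨rfl, fun t ht => h1 t ht rfl⟩
      rw [placedEdges_eq_nil (snd_eq_leaf_of_mem_rootPlaced hall j), placedEdges_eq_nil, label]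
      intro x hx
      obtain ⟨t, ht, rfl⟩ := List.mem_map.1 hx
      exact hall t ht
    | node s c =>
      obtain ⟨l, hl, hl'⟩ := exists_edgesFrom_node s c k hk
      rw [rootPlaced, placedEdges, hl', List.map_cons, placedEdges, hl', ih h2 (by omega),
        List.cons_append, List.cons_append, label, if_pos le_rfl, label_append hl]

/-- The letter of a connection word attached to an edge, for an arity map `A` on the nodes. -/
def cncLetter (A : ℕ → ℕ) (e : ℕ × ℕ) : ℚ := (e.1 : ℚ) + 1 - (2 : ℚ) ^ ((e.2 : ℤ) - (A e.1 : ℤ))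

theorem cncLetter_lt (A : ℕ → ℕ) (e : ℕ × ℕ) : cncLetter A e < e.1 + 1 := by
  rw [cncLetter]
  have : (0 : ℚ) < (2 : ℚ) ^ ((e.2 : ℤ) - (A e.1 : ℤ)) := by positivity
  linarith

theorem le_cncLetter {A : ℕ → ℕ} {e : ℕ × ℕ} (h : e.2 ≤ A e.1) : e.1 ≤ cncLetter A e := by
  rw [cncLetter]
  have : (2 : ℚ) ^ ((e.2 : ℤ) - (A e.1 : ℤ)) ≤ 1 := zpow_le_one_of_nonpos₀ (by norm_num) (by omega)
  linarith

theorem cncLetter_le_iff_snd (A : ℕ → ℕ) (p l l' : ℕ) :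
    cncLetter A (p, l) ≤ cncLetter A (p, l') ↔ l' ≤ l := by
  rw [cncLetter, cncLetter, sub_le_sub_iff_left, zpow_le_zpow_iff_right₀ (by norm_num)]
  simp

/-- The integer part of a letter gives the parent; at equal parents the letter decreases with the
position. -/
theorem slotLE_of_cncLetter_le {A : ℕ → ℕ} {e e' : ℕ × ℕ} (h : e.2 ≤ A e.1)
    (hle : cncLetter A e ≤ cncLetter A e') : SlotLE e e' := by
  have h1 : (e.1 : ℚ) < e'.1 + 1 := (le_cncLetter h).trans_lt (hle.trans_lt (cncLetter_lt A e'))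
  have h2 : e.1 < e'.1 + 1 := by exact_mod_cast h1
  rcases (Nat.lt_succ_iff.1 h2).lt_or_eq with h3 | h3
  · exact Or.inl h3
  · obtain ⟨p, l⟩ := e
    obtain ⟨p', l'⟩ := e'
    obtain rfl : p = p' := h3
    exact Or.inr ⟨rfl, (cncLetter_le_iff_snd A p l l').1 hle⟩

theorem cncLetter_le_of_lt {A : ℕ → ℕ} {e e' : ℕ × ℕ} (h : e'.2 ≤ A e'.1) (hlt : e.1 < e'.1) :
    cncLetter A e ≤ cncLetter A e' := by
  refine (cncLetter_lt A e).le.trans (le_trans ?_ (le_cncLetter h))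
  exact_mod_cast hlt

theorem cncLetter_le_of_slotLE {A : ℕ → ℕ} {e e' : ℕ × ℕ} (h : e'.2 ≤ A e'.1)
    (hle : SlotLE e e') : cncLetter A e ≤ cncLetter A e' := by
  rcases hle with h1 | ⟨h1, h2⟩
  · exact cncLetter_le_of_lt h h1
  · obtain ⟨p, l⟩ := e
    obtain ⟨p', l'⟩ := e'
    obtain rfl : p = p' := h1
    exact (cncLetter_le_iff_snd A p l l').2 h2

/-- The code forgets positions at the root without losing the order: a smaller word has read at
least as many root children, which is the invariant `j' ≤ j`. So its next root position is at least
as large, and its letter at most as large. -/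
theorem wordLE_iff_cncLetter (A : ℕ → ℕ) {w w' : List (S × ℕ × ℕ)}
    (hw : ∀ x ∈ w, x.2 = (1, 0) ∨ 2 ≤ x.2.1 ∧ x.2.2 ≤ A x.2.1)
    (hw' : ∀ x ∈ w', x.2 = (1, 0) ∨ 2 ≤ x.2.1 ∧ x.2.2 ≤ A x.2.1)
    (hd : w.map Prod.fst = w'.map Prod.fst) {j j' : ℕ} (hj : j' ≤ j) :
    WordLE w w' ↔ List.Forall₂ (· ≤ ·) ((label j (w.map Prod.snd)).map (cncLetter A))
      ((label j' (w'.map Prod.snd)).map (cncLetter A)) := by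
  induction w generalizing w' j j' with
  | nil =>
    obtain rfl := List.map_eq_nil_iff.1 hd.symm
    exact ⟨fun _ => List.Forall₂.nil, fun _ => List.Forall₂.nil⟩
  | cons x w ih =>
    cases w' with
    | nil => simp at hd
    | cons x' w' =>
      obtain ⟨s, e⟩ := x
      obtain ⟨s', e'⟩ := x'
      obtain ⟨hd1, hd2⟩ := List.cons.inj hd
      obtain rfl : s = s' := hd1
      obtain ⟨h1, h2⟩ := List.forall_mem_cons.1 hw
      obtain ⟨h1', h2'⟩ := List.forall_mem_cons.1 hw'
      simp only at h1 h1'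
      have hcons : WordLE ((s, e) :: w) ((s, e') :: w') ↔ SlotLE e e' ∧ WordLE w w' := by
        rw [WordLE, List.forall₂_cons]
        simp [WordLE]
      rw [hcons, List.map_cons, List.map_cons, label, label]
      rcases h1 with rfl | h1 <;> rcases h1' with rfl | h1'
      · rw [if_pos le_rfl, if_pos le_rfl, List.map_cons, List.map_cons, List.forall₂_cons,
          ih h2 h2' hd2 (Nat.succ_le_succ hj)]
        refine and_congr_left fun _ => ⟨fun _ => ?_, fun _ => Or.inr ⟨rfl, le_rfl⟩⟩
        exact (cncLetter_le_iff_snd A 1 _ _).2 (Nat.succ_le_succ hj)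
      · rw [if_pos le_rfl, if_neg (not_le.2 h1'.1), List.map_cons, List.map_cons, List.forall₂_cons,
          ih h2 h2' hd2 (Nat.le_succ_of_le hj)]
        refine and_congr_left fun _ => ⟨fun _ => ?_, fun _ => Or.inl h1'.1⟩
        exact cncLetter_le_of_lt h1'.2 h1'.1
      · rw [if_neg (not_le.2 h1.1), if_pos le_rfl, List.map_cons, List.map_cons, List.forall₂_cons]
        -- A slot of another node is never below the root slot, and the same holds for their
        -- letters.
        refine iff_of_false (fun h => ?_) (fun h => ?_)
        · have := h.1
          unfold SlotLE at this
          simp only at this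
          omega
        · have := slotLE_of_cncLetter_le h1.2 h.1
          unfold SlotLE at this
          simp only at this
          omega
      · rw [if_neg (not_le.2 h1.1), if_neg (not_le.2 h1'.1), List.map_cons, List.map_cons,
          List.forall₂_cons, ih h2 h2' hd2 hj]
        exact and_congr_left fun _ =>
          ⟨cncLetter_le_of_slotLE h1'.2, slotLE_of_cncLetter_le h1.2⟩

theorem cnc_toTerm {f : Forest ar} (hf : f.IsRootTilted) :
    f.toTerm.cnc = cncLetter f.toTerm.arityAt (1, 0) ::
      (label 0 ((forestWord (List.ofFn f.trees)).map Prod.snd)).map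
        (cncLetter f.toTerm.arityAt) := by
  rw [cnc, parentEdges_toTerm, placedEdges_rootPlaced hf.isTilted le_rfl, forestWord,
    map_snd_placedWord]
  rfl

theorem forestWord_snd_le (f : Forest ar) : ∀ x ∈ forestWord (List.ofFn f.trees),
    x.2 = (1, 0) ∨ 2 ≤ x.2.1 ∧ x.2.2 ≤ f.toTerm.arityAt x.2.1 := by
  intro x hx
  have h1 := isNormal_forestWord _ x hx
  have h2 := (isValid_forestWord (List.ofFn f.trees)).snd_le f.toTerm.arityAt
    (fun i hi => ?_) (by simp) x hx
  · tauto
  · rw [arityAt, dc_toTerm]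
    simp [show 2 + i - 1 = i + 1 by omega, hi]

theorem length_forestWord_of_isBalanced {f : Forest ar} (hf : f.IsBalanced) :
    (forestWord (List.ofFn f.trees)).length = f.n := by
  rw [Forest.IsBalanced, Forest.deg_toTerm] at hf
  rw [length_forestWord, List.map_ofFn, List.sum_ofFn]
  simp only [Function.comp_apply]
  omega

/-- Balance makes the root decoration the length of the word, so equal decorations off the root
suffice. Both connection words then use the same arities. -/
theorem toTerm_le_toTerm_iff {f f' : Forest ar} (hf : f.IsLeaning) (hf' : f'.IsLeaning) :
    f.toTerm ≤ f'.toTerm ↔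
      WordLE (forestWord (List.ofFn f.trees)) (forestWord (List.ofFn f'.trees)) := by
  have hdc : f.toTerm.dc = f'.toTerm.dc ↔ (forestWord (List.ofFn f.trees)).map Prod.fst
      = (forestWord (List.ofFn f'.trees)).map Prod.fst := by
    rw [dc_toTerm, dc_toTerm, List.cons_eq_cons, Sum.inr.injEq,
      (List.map_injective_iff.2 Sum.inl_injective).eq_iff, and_iff_right_of_imp]
    intro h
    have := congrArg List.length h
    rwa [List.length_map, List.length_map, length_forestWord_of_isBalanced hf.1,
      length_forestWord_of_isBalanced hf'.1] at this
  have hword : WordLE (forestWord (List.ofFn f.trees)) (forestWord (List.ofFn f'.trees)) →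
      (forestWord (List.ofFn f.trees)).map Prod.fst
        = (forestWord (List.ofFn f'.trees)).map Prod.fst := by
    intro h
    rw [← List.forall₂_eq_eq_eq, List.forall₂_map_left_iff, List.forall₂_map_right_iff]
    exact h.imp fun _ _ h => h.1
  change f.toTerm.dc = f'.toTerm.dc ∧ List.Forall₂ (· ≤ ·) f.toTerm.cnc f'.toTerm.cnc ↔ _
  by_cases hd : f.toTerm.dc = f'.toTerm.dc
  · have hA : f.toTerm.arityAt = f'.toTerm.arityAt := by
      funext i
      rw [arityAt, arityAt, hd]
    have h' := forestWord_snd_le f'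
    rw [← hA] at h'
    rw [cnc_toTerm hf.2, cnc_toTerm hf'.2, ← hA, List.forall₂_cons, and_iff_right hd,
      and_iff_right le_rfl]
    exact (wordLE_iff_cncLetter _ (forestWord_snd_le f) h' (hdc.1 hd) le_rfl).symm
  · exact iff_of_false (fun h => hd h.1) (fun h => hd (hdc.2 (hword h)))

end ForestWords

/-! ### The poset of leaning forests -/

namespace LeaningForest

variable {S : Type u} {ar : S → ℕ}

/-- The word of the nodes of a leaning forest, without its root. -/
def code (f : LeaningForest ar) : List (S × ℕ × ℕ) := forestWord (List.ofFn f.1.trees)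

theorem le_iff {f f' : LeaningForest ar} : f ≤ f' ↔ WordLE f.code f'.code :=
  toTerm_le_toTerm_iff f.2 f'.2

theorem length_code (f : LeaningForest ar) : f.code.length = f.1.n :=
  length_forestWord_of_isBalanced f.2.1

theorem isValid_code (f : LeaningForest ar) : IsValid ar 2 [] f.code := isValid_forestWord _

theorem isNormal_code (f : LeaningForest ar) : IsNormal f.code := isNormal_forestWord _

/-! ### Leaning forests, words of terms and valid codes -/

/-- The terms different from the leaf of a leaning forest. -/
def terms (f : LeaningForest ar) : List (Term ar) := f.word.toList.map Subtype.val

theorem ne_leaf_of_mem_terms (f : LeaningForest ar) : ∀ t ∈ f.terms, t ≠ .leaf := by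
  intro t ht
  obtain ⟨t, -, rfl⟩ := List.mem_map.1 ht
  exact t.2

/-- The list of the terms different from the leaf of a list of terms. -/
def nonLeaves (ts : List (Term ar)) : List {t : Term ar // t ≠ .leaf} :=
  ts.filterMap fun t => if h : t ≠ .leaf then some ⟨t, h⟩ else none

theorem nonLeaves_of_leaves {ts : List (Term ar)} (h : ∀ t ∈ ts, t = .leaf) :
    nonLeaves ts = [] := by
  rw [nonLeaves, List.filterMap_eq_nil_iff]
  intro t ht
  rw [dif_neg (not_not.2 (h t ht))]

theorem nonLeaves_map_append (u : List {t : Term ar // t ≠ .leaf}) (ts : List (Term ar)) :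
    nonLeaves (u.map Subtype.val ++ ts) = u ++ nonLeaves ts := by
  induction u with
  | nil => rfl
  | cons t u ih =>
    rw [List.map_cons, List.cons_append, nonLeaves, List.filterMap_cons, dif_pos t.2,
      List.cons_append, ← ih]
    rfl

theorem _root_.EasterlyWind.IsTilted.eq_append {ts : List (Term ar)} (h : IsTilted ts) :
    ∃ m, ts = (nonLeaves ts).map Subtype.val ++ List.replicate m .leaf := by
  induction ts with
  | nil => exact ⟨0, rfl⟩
  | cons t ts ih =>
    obtain ⟨h1, h2⟩ := List.pairwise_cons.1 h
    by_cases ht : t = .leaf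
    · have hall : ∀ t' ∈ t :: ts, t' = .leaf :=
        List.forall_mem_cons.2 ⟨ht, fun t' ht' => h1 t' ht' ht⟩
      refine ⟨ts.length + 1, ?_⟩
      rw [nonLeaves_of_leaves hall]
      exact List.eq_replicate_iff.2 ⟨rfl, hall⟩
    · obtain ⟨m, hm⟩ := ih h2
      refine ⟨m, ?_⟩
      rw [nonLeaves, List.filterMap_cons, dif_pos ht, List.map_cons, List.cons_append]
      exact congrArg (t :: ·) hm

theorem exists_ofFn_trees_eq (f : LeaningForest ar) :
    ∃ m, List.ofFn f.1.trees = f.terms ++ List.replicate m .leaf :=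
  f.2.2.isTilted.eq_append

theorem code_eq_forestWord_terms (f : LeaningForest ar) : f.code = forestWord f.terms := by
  obtain ⟨m, hm⟩ := f.exists_ofFn_trees_eq
  rw [code, hm, forestWord_append_leaves]

theorem code_injective : Function.Injective (code : LeaningForest ar → List (S × ℕ × ℕ)) := by
  intro f f' h
  have hterms : f.terms = f'.terms := by
    rw [code_eq_forestWord_terms, code_eq_forestWord_terms] at h
    exact (placedWord_injective 2 _ le_rfl (M := []) (M' := []) rfl f.ne_leaf_of_mem_terms
      f'.ne_leaf_of_mem_terms (isStack_nil 2) rfl h).2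
  have hn : f.1.n = f'.1.n := by rw [← length_code, h, length_code]
  obtain ⟨m, hm⟩ := f.exists_ofFn_trees_eq
  obtain ⟨m', hm'⟩ := f'.exists_ofFn_trees_eq
  obtain rfl : m = m' := by
    have h1 := congrArg List.length hm
    have h2 := congrArg List.length hm'
    rw [List.length_append, List.length_replicate, List.length_ofFn] at h1 h2
    rw [← hterms] at h2
    omega
  rw [hterms, ← hm'] at hm
  obtain ⟨⟨n, t⟩, hf⟩ := f
  obtain ⟨⟨n', t'⟩, hf'⟩ := f'
  obtain rfl : n = n' := hn
  obtain rfl : t = t' := List.ofFn_injective hm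
  rfl

instance instPartialOrder : PartialOrder (LeaningForest ar) where
  toPreorder := instPreorder
  le_antisymm _ _ h h' := code_injective ((le_iff.1 h).antisymm (le_iff.1 h'))

/-- The word is padded with leaves until its length is the total degree; there is room because each
term other than the leaf has degree at least `1`. -/
theorem exists_word_eq (u : FreeMonoid {t : Term ar // t ≠ .leaf}) :
    ∃ f : LeaningForest ar, f.word = u := by
  set ts : List (Term ar) := u.toList.map Subtype.val with hts
  have hpos : ∀ d ∈ ts.map Term.deg, 1 ≤ d := by
    intro d hd
    obtain ⟨t, ht, rfl⟩ := List.mem_map.1 hd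
    obtain ⟨⟨t, ht'⟩, -, rfl⟩ := List.mem_map.1 ht
    cases t with
    | leaf => exact absurd rfl ht'
    | node s c => rw [Term.deg_node]; omega
  have hle : ts.length ≤ (ts.map Term.deg).sum := by
    have := List.length_le_sum_of_one_le _ hpos
    rwa [List.length_map] at this
  set l : List (Term ar) := ts ++ List.replicate ((ts.map Term.deg).sum - ts.length) .leaf with hl
  have hlen : l.length = (ts.map Term.deg).sum := by
    rw [hl, List.length_append, List.length_replicate]
    omega
  have hsum : (l.map Term.deg).sum = (ts.map Term.deg).sum := by
    rw [hl, List.map_append, List.sum_append, List.map_replicate, Term.deg_leaf]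
    simp
  have htilt : IsTilted l := by
    refine List.pairwise_append.2 ⟨?_, ?_, ?_⟩
    · refine List.pairwise_iff_getElem.2 fun i _ hi _ _ h => absurd h ?_
      obtain ⟨t, -, ht⟩ := List.mem_map.1 (List.getElem_mem hi)
      rw [← ht]
      exact t.2
    · exact List.pairwise_replicate.2 (Or.inr fun h => h)
    · intro _ _ t ht _
      exact List.eq_of_mem_replicate ht
  refine ⟨⟨⟨l.length, l.get⟩, ?_, ?_⟩, ?_⟩
  · rw [Forest.IsBalanced, Forest.deg_toTerm]
    have : ∑ j : Fin l.length, (l.get j).deg = (l.map Term.deg).sum := by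
      rw [← List.sum_ofFn]
      congr 1
      exact List.ext_getElem (by simp) (by simp)
    simp only
    rw [this, hsum, ← hlen, add_comm]
  · intro i j hij h
    exact List.pairwise_iff_get.1 htilt i j hij h
  · change FreeMonoid.ofList (nonLeaves (List.ofFn l.get)) = u
    rw [List.ofFn_get, hl, hts, nonLeaves_map_append,
      nonLeaves_of_leaves fun t ht => List.eq_of_mem_replicate ht, List.append_nil]
    rfl

theorem exists_code_eq {w : List (S × ℕ × ℕ)} (hw : IsValid ar 2 [] w) :
    ∃ f : LeaningForest ar, f.code = w := by
  obtain ⟨M, ts, hM, hts, rfl⟩ := exists_placedWord_eq le_rfl (isStack_nil 2) hw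
  obtain rfl := List.map_eq_nil_iff.1 hM
  obtain ⟨f, hf⟩ := exists_word_eq (FreeMonoid.ofList (ts.pmap Subtype.mk hts))
  refine ⟨f, ?_⟩
  rw [code_eq_forestWord_terms, terms, hf, FreeMonoid.toList_ofList, List.map_pmap]
  simp only [List.pmap_eq_map, List.map_id']
  rfl

/-! ### Cutting and gluing leaning forests -/

/-- The leaning forest identified with the concatenation of the words of two
leaning forests. -/
noncomputable def juxtapose (f₁ f₂ : LeaningForest ar) : LeaningForest ar :=
  (exists_word_eq (f₁.word * f₂.word)).choose

theorem word_juxtapose (f₁ f₂ : LeaningForest ar) : (f₁.juxtapose f₂).word = f₁.word * f₂.word :=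
  (exists_word_eq (f₁.word * f₂.word)).choose_spec

theorem code_juxtapose (f₁ f₂ : LeaningForest ar) :
    (f₁.juxtapose f₂).code = f₁.code ++ attach f₁.code.length [] f₂.code := by
  have h : (f₁.juxtapose f₂).terms = f₁.terms ++ f₂.terms := by
    rw [terms, word_juxtapose, FreeMonoid.toList_mul, List.map_append]
    rfl
  rw [code_eq_forestWord_terms, h, forestWord_append f₂.ne_leaf_of_mem_terms,
    ← code_eq_forestWord_terms, ← code_eq_forestWord_terms]

theorem code_under (f₁ f₂ : LeaningForest ar) : (f₁.under f₂).code
    = f₁.code ++ attach f₁.code.length (finalStack ar 2 [] f₁.code) f₂.code :=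
  forestWord_under f₁.1 f₂.1 f₂.2.2

theorem exists_code_eq_take (n : ℕ) (f : LeaningForest ar) :
    ∃ g : LeaningForest ar, g.code = f.code.take n := by
  refine exists_code_eq ?_
  have := f.isValid_code
  rw [← List.take_append_drop n f.code] at this
  exact (isValid_append.1 this).1

theorem exists_code_eq_drop (n : ℕ) (f : LeaningForest ar) :
    ∃ g : LeaningForest ar, g.code = restrict n (f.code.drop n) := by
  -- The prefix has length `n` only if the code is long enough; otherwise the remaining part is
  -- empty.
  by_cases hn : f.code.length ≤ n
  · refine exists_code_eq ?_
    rw [List.drop_eq_nil_of_le hn]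
    trivial
  · have h := f.isValid_code
    rw [← List.take_append_drop n f.code] at h
    have hlen : (f.code.take n).length = n := by
      rw [List.length_take]
      omega
    have h1 := (isValid_append.1 h).2
    have h2 := (isStack_finalStack (ar := ar) (f.code.take n) le_rfl (isStack_nil 2)).2
    rw [hlen] at h1 h2
    refine exists_code_eq (h1.restrict le_rfl fun e he hlt => ?_)
    have := h2 e he
    omega

/-- The leaning forest of the first `n` nodes of a leaning forest. -/
noncomputable def initial (n : ℕ) (f : LeaningForest ar) : LeaningForest ar :=
  (exists_code_eq_take n f).choose

/-- The leaning forest of the nodes of a leaning forest after the first `n` ones. -/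
noncomputable def final (n : ℕ) (f : LeaningForest ar) : LeaningForest ar :=
  (exists_code_eq_drop n f).choose

theorem code_initial (n : ℕ) (f : LeaningForest ar) : (f.initial n).code = f.code.take n :=
  (exists_code_eq_take n f).choose_spec

theorem code_final (n : ℕ) (f : LeaningForest ar) :
    (f.final n).code = restrict n (f.code.drop n) :=
  (exists_code_eq_drop n f).choose_spec

theorem juxtapose_le_iff {f₁ f₂ f : LeaningForest ar} :
    f₁.juxtapose f₂ ≤ f ↔ f₁ ≤ f.initial f₁.1.n ∧ f₂ ≤ f.final f₁.1.n := by
  rw [le_iff, le_iff, le_iff, code_juxtapose, code_initial, code_final, ← length_code]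
  exact append_attach_nil_le_iff f₂.isNormal_code f.isNormal_code

theorem le_under_iff {f₁ f₂ f : LeaningForest ar} :
    f ≤ f₁.under f₂ ↔ f.initial f₁.1.n ≤ f₁ ∧ f.final f₁.1.n ≤ f₂ := by
  rw [le_iff, le_iff, le_iff, code_under, code_initial, code_final, ← length_code]
  exact le_append_attach_iff f₂.isNormal_code f.isValid_code

theorem size_eq_of_le {f g : LeaningForest ar} (h : f ≤ g) : f.1.n = g.1.n := by
  rw [← length_code, ← length_code]
  exact (le_iff.1 h).length_eq

/-- The leaning forests `f` whose initial and final parts are `f₁` and `f₂`. -/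
noncomputable def shuffles (f₁ f₂ : LeaningForest ar) : Finset (LeaningForest ar) :=
  (Finset.Ici (f₁.juxtapose f₂)).filter fun f => (f.initial f₁.1.n, f.final f₁.1.n) = (f₁, f₂)

/-- The upper set in `shuffles` only serves to make the fibre a `Finset`. -/
theorem mem_shuffles {f₁ f₂ f : LeaningForest ar} :
    f ∈ f₁.shuffles f₂ ↔ (f.initial f₁.1.n, f.final f₁.1.n) = (f₁, f₂) := by
  rw [shuffles, Finset.mem_filter, Finset.mem_Ici, juxtapose_le_iff, and_iff_right_of_imp]
  intro h
  rw [Prod.mk.injEq] at h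
  exact ⟨h.1.ge, h.2.ge⟩

end LeaningForest

/-! ### Products of basis elements -/

section Products

variable (K : Type v) [Field K] {S : Type u} {ar : S → ℕ}

open LeaningForest

theorem basisE_mul_basisE (f₁ f₂ : LeaningForest ar) :
    basisE K f₁ * basisE K f₂ = basisE K (f₁.juxtapose f₂) := by
  rw [basisE, basisE, basisE, word_juxtapose, map_mul]

/-- Möbius inversion: the coefficient of `basisE K h` is the sum of `μ(g, h)` over `f ≤ g ≤ h`,
which vanishes unless `h = f`. -/
theorem basisE_eq_sum_basisF (f : LeaningForest ar) :
    basisE K f = ∑ g ∈ Finset.Ici f, basisF K g := by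
  have h : ∀ g ∈ Finset.Ici f, basisF K g
      = ∑ h ∈ Finset.Ici f, (if g ≤ h then IncidenceAlgebra.mu K g h else 0) • basisE K h := by
    intro g hg
    simp only [ite_smul, zero_smul]
    rw [← Finset.sum_filter]
    refine Finset.sum_congr ?_ fun _ _ => rfl
    ext h
    rw [Finset.mem_filter, Finset.mem_Ici, Finset.mem_Ici]
    exact ⟨fun h' => ⟨(Finset.mem_Ici.1 hg).trans h', h'⟩, fun h' => h'.2⟩
  rw [Finset.sum_congr rfl h, Finset.sum_comm]
  simp only [← Finset.sum_smul]
  rw [Finset.sum_eq_single_of_mem f (Finset.mem_Ici.2 le_rfl)]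
  · rw [Finset.sum_eq_single_of_mem f (Finset.mem_Ici.2 le_rfl), if_pos le_rfl,
      IncidenceAlgebra.mu_self, one_smul]
    intro g hg hne
    rw [if_neg fun h => hne (le_antisymm h (Finset.mem_Ici.1 hg))]
  · intro h _ hne
    rw [← Finset.sum_filter]
    have : (Finset.Ici f).filter (· ≤ h) = Finset.Icc f h := by ext; simp
    rw [this, IncidenceAlgebra.sum_Icc_mu_left, if_neg hne.symm, zero_smul]

/-- `I` is the preimage of `J₁ ×ˢ J₂` under the cut after `n` nodes, and the sum is grouped by
fibres. It serves both for the upper set of `juxtapose` and for the lower set of `under`. -/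
theorem sum_basisF_eq_sum_shuffles (n : ℕ)
    (I : Finset (LeaningForest ar)) (J₁ J₂ : Finset (LeaningForest ar))
    (hn : ∀ g ∈ J₁, g.1.n = n)
    (h : ∀ f, f ∈ I ↔ f.initial n ∈ J₁ ∧ f.final n ∈ J₂) :
    ∑ f ∈ I, basisF K f = ∑ g ∈ J₁ ×ˢ J₂, ∑ f ∈ g.1.shuffles g.2, basisF K f := by
  rw [← Finset.sum_fiberwise_of_maps_to (s := I) (t := J₁ ×ˢ J₂)
    (g := fun f => (f.initial n, f.final n))
    fun f hf => Finset.mem_product.2 ((h f).1 hf)]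
  refine Finset.sum_congr rfl fun g hg => Finset.sum_congr ?_ fun _ _ => rfl
  ext f
  obtain ⟨g₁, g₂⟩ := g
  have hg' := Finset.mem_product.1 hg
  rw [Finset.mem_filter, mem_shuffles, hn _ hg'.1, and_iff_right_of_imp]
  intro hf
  rw [h]
  rw [Prod.mk.injEq] at hf
  rw [hf.1, hf.2]
  exact hg'

/-- Expanding `E_{f₁} E_{f₂}` in the `F` in two ways gives the sum of these identities over all
pairs `(g₁, g₂) ≥ (f₁, f₂)`. The other pairs have smaller products of upper sets, so their
identities hold by induction and cancel. -/
theorem basisF_mul_basisF (f₁ f₂ : LeaningForest ar) :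
    basisF K f₁ * basisF K f₂ = ∑ f ∈ f₁.shuffles f₂, basisF K f := by
  generalize hN : (Finset.Ici f₁ ×ˢ Finset.Ici f₂).card = N
  induction N using Nat.strong_induction_on generalizing f₁ f₂ with
  | _ N ih =>
    have h1 := basisE_mul_basisE K f₁ f₂
    rw [basisE_eq_sum_basisF K f₁, basisE_eq_sum_basisF K f₂, Finset.sum_mul_sum,
      ← Finset.sum_product', basisE_eq_sum_basisF,
      sum_basisF_eq_sum_shuffles K f₁.1.n (Finset.Ici (f₁.juxtapose f₂)) (Finset.Ici f₁)
        (Finset.Ici f₂) (fun g hg => (size_eq_of_le (Finset.mem_Ici.1 hg)).symm)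
        (fun f => by simp only [Finset.mem_Ici, juxtapose_le_iff])] at h1
    have hmem : (f₁, f₂) ∈ Finset.Ici f₁ ×ˢ Finset.Ici f₂ := by simp
    rw [← Finset.add_sum_erase _ _ hmem, ← Finset.add_sum_erase _ _ hmem] at h1
    rw [Finset.sum_congr rfl fun g hg => ?_] at h1
    · exact add_right_cancel h1
    · obtain ⟨hne, hg⟩ := Finset.mem_erase.1 hg
      obtain ⟨h2, h3⟩ := Finset.mem_product.1 hg
      rw [Finset.mem_Ici] at h2 h3
      refine ih _ ?_ g.1 g.2 rfl
      rw [← hN]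
      refine Finset.card_lt_card (Finset.ssubset_iff_of_subset
        (Finset.product_subset_product (Finset.Ici_subset_Ici.2 h2)
          (Finset.Ici_subset_Ici.2 h3)) |>.2 ⟨_, hmem, fun h => hne ?_⟩)
      obtain ⟨h4, h5⟩ := Finset.mem_product.1 h
      exact Prod.ext (le_antisymm (Finset.mem_Ici.1 h4) h2) (le_antisymm (Finset.mem_Ici.1 h5) h3)

end Products

end EasterlyWind

theorem mainTheorem2 {S : Type*} (ar : S → ℕ) (K : Type*) [Field K]
    (f₁ f₂ : EasterlyWind.LeaningForest ar) :
    EasterlyWind.basisH K f₁ * EasterlyWind.basisH K f₂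
      = EasterlyWind.basisH K (f₁.under f₂) := by
  rw [EasterlyWind.basisH, EasterlyWind.basisH, EasterlyWind.basisH, Finset.sum_mul_sum,
    ← Finset.sum_product', EasterlyWind.sum_basisF_eq_sum_shuffles K f₁.1.n (Finset.Iic (f₁.under f₂)) (Finset.Iic f₁)
      (Finset.Iic f₂) (fun g hg => EasterlyWind.LeaningForest.size_eq_of_le (Finset.mem_Iic.1 hg))
      (fun f => by simp only [Finset.mem_Iic, EasterlyWind.LeaningForest.le_under_iff])]
  exact Finset.sum_congr rfl fun g _ => EasterlyWind.basisF_mul_basisF K g.1 g.2
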